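/- Let $\gamma>0$, $0<\alpha\le 1$ and $\max(1,\alpha\gamma)\le\sigma<1+\alpha\gamma$. Let $$E^{\gamma}_{\alpha,\sigma}(z)=\frac1{\Gamma(\gamma)}\sum_{k=0}^\infty\frac{\Gamma(k+\gamma)\,z^k}{k!\,\Gamma(\alpha k+\sigma)}$$ be the Prabhakar (three-parameter Mittag-Leffler) function. For $\lambda>0$, the Prabhakar Lévy process with rate $\lambda$ is the driftless subordinator with Lévy measure $$\nu_\lambda(dx)=\frac{\alpha\,\Gamma(\gamma)}{\Gamma\left(\gamma+\frac{1-\sigma}{\alpha}\right)}\,x^{\sigma-2}\,E^{\gamma}_{\alpha,\sigma}(-\lambda x^\alpha)\,dx,\qquad x>0,$$ and the Prabhakar distribution is the law of $M=X_1$, where $X$ is a Prabhakar Lévy process with $\lambda=1$. Then the density of $\nu_1$ is nonnegative on $(0,\infty)$ and $\int_0^\infty\min(1,x)\,\nu_1(dx)<\infty$, so that $\nu_1$ is indeed the Lévy measure of a subordinator; and for every $s\ge 0$ the Laplace transform of the Prabhakar distribution is $$\mathbb E\left(e^{-sM}\right)=\exp\left(-\frac{s^{\alpha\gamma-\sigma+1}\,\Gamma(\gamma)}{\Gamma\left(\gamma+1+\frac{1-\sigma}{\alpha}\right)}\;{}_2F_1\left(\gamma,\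 \gamma+\tfrac{1-\sigma}{\alpha};\ 1+\gamma+\tfrac{1-\sigma}{\alpha};\ -s^\alpha\right)\right),$$ where ${}_2F_1$ is the Gauss hypergeometric function, continued analytically to $\mathbb C\setminus[1,\infty)$. -/

import Mathlib

open MeasureTheory ProbabilityTheory Filter Topology
open scoped NNReal ENNReal

/-- The Prabhakar (three-parameter Mittag-Leffler) function `E^γ_{α,σ}(z)`, for real parameters
and real argument. -/
noncomputable def prabhakarE (α σ γ z : ℝ) : ℝ :=
  (1 / Real.Gamma γ) *
    ∑' k : ℕ, Real.Gamma (k + γ) * z ^ k / ((k.factorial : ℝ) * Real.Gamma (α * k + σ))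

/-- The density on `(0, ∞)` of the Lévy measure of the Prabhakar process with rate `lam`. -/
noncomputable def prabhakarLevyDensity (α σ γ lam x : ℝ) : ℝ :=
  α * Real.Gamma γ / Real.Gamma (γ + (1 - σ) / α) *
    x ^ (σ - 2) * prabhakarE α σ γ (-(lam * x ^ α))

/-- The Lévy measure of the Prabhakar process, a measure on `ℝ` carried by `(0, ∞)`. -/
noncomputable def prabhakarLevyMeasure (α σ γ lam : ℝ) : Measure ℝ :=
  (volume.restrict (Set.Ioi 0)).withDensity
    (fun x => ENNReal.ofReal (prabhakarLevyDensity α σ γ lam x))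

/-- `ν` is the Lévy measure of some subordinator: it is carried by `(0, ∞)` and integrates
`min 1 x`. -/
structure IsSubordinatorLevyMeasure (ν : Measure ℝ) : Prop where
  measure_Iic : ν (Set.Iic 0) = 0
  lintegral_lt_top : ∫⁻ x, ENNReal.ofReal (min 1 x) ∂ν < ∞

/-- A real Lévy process: it starts at `0`, has independent and stationary increments, and is
continuous in probability. -/
structure IsLevyProcess {Ω : Type*} [MeasurableSpace Ω] (X : ℝ≥0 → Ω → ℝ) (P : Measure Ω) :
    Prop where
  aemeasurable : ∀ t, AEMeasurable (X t) P
  start_zero : ∀ᵐ ω ∂P, X 0 ω = 0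
  indep_increments : HasIndepIncrements X P
  stationary_increments : ∀ s t, IdentDistrib (fun ω => X (s + t) ω - X s ω) (X t) P P
  continuous_in_measure : ∀ t, TendstoInMeasure P X (𝓝 t) (X t)

/-- A subordinator: an almost surely nondecreasing real Lévy process. -/
structure IsSubordinator {Ω : Type*} [MeasurableSpace Ω] (X : ℝ≥0 → Ω → ℝ) (P : Measure Ω) :
    Prop extends IsLevyProcess X P where
  mono : ∀ s t, s ≤ t → ∀ᵐ ω ∂P, X s ω ≤ X t ω

/-- The subordinator `X` has drift `d` and Lévy measure `ν`, by the Lévy–Khintchine formula for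
its characteristic function:
`E exp(i u X_t) = exp (t (i u d + ∫ (exp(i u x) - 1) ν(dx)))`. -/
structure HasDriftAndLevyMeasure {Ω : Type*} [MeasurableSpace Ω] (X : ℝ≥0 → Ω → ℝ)
    (P : Measure Ω) (d : ℝ) (ν : Measure ℝ) : Prop where
  isLevyMeasure : IsSubordinatorLevyMeasure ν
  charFun_eq : ∀ (t : ℝ≥0) (u : ℝ), charFun (P.map (X t)) u =
    Complex.exp (((t : ℝ) : ℂ) * (Complex.I * u * d +
      ∫ x, (Complex.exp (Complex.I * u * x) - 1) ∂ν))

/-- A Prabhakar Lévy process with rate `lam`: the driftless subordinator with the Prabhakar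
Lévy measure. -/
structure IsPrabhakarProcess {Ω : Type*} [MeasurableSpace Ω] (α σ γ lam : ℝ)
    (X : ℝ≥0 → Ω → ℝ) (P : Measure Ω) : Prop where
  isSubordinator : IsSubordinator X P
  hasLevyMeasure : HasDriftAndLevyMeasure X P 0 (prabhakarLevyMeasure α σ γ lam)

/-- The complex plane cut along `[1, ∞)`. -/
def cutPlane : Set ℂ := {z | 1 - z ∈ Complex.slitPlane}

open Classical in
/-- The principal branch of the Gauss hypergeometric function: the analytic continuation of the
sum of the hypergeometric series from the unit disc to the plane cut along `[1, ∞)`. (Mathlib's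
`₂F₁` is the sum of the series, which is meaningless outside the closed unit disc.) -/
noncomputable def gaussHypergeometric (a b c z : ℂ) : ℂ :=
  if h : ∃ F : ℂ → ℂ, AnalyticOnNhd ℂ F cutPlane ∧ ∀ w, ‖w‖ < 1 → F w = ₂F₁ a b c w then
    h.choose z
  else 0

theorem isPreconnected_cutPlane : IsPreconnected cutPlane := by
  have h : IsPreconnected Complex.slitPlane := by
    exact (Complex.starConvex_one_slitPlane.isPathConnected
      (by simp)).isConnected.isPreconnected
  have e : cutPlane = (fun z : ℂ => 1 - z) '' Complex.slitPlane := by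
    ext z
    constructor
    · intro hz
      exact ⟨1 - z, hz, by simp⟩
    · rintro ⟨w, hw, rfl⟩
      simpa [cutPlane] using hw
  rw [e]
  exact h.image _ (by fun_prop)

/-- The continuation is unique, so the definition does not depend on a choice. -/
theorem gaussHypergeometric_eq {a b c : ℂ} {F : ℂ → ℂ} (hF : AnalyticOnNhd ℂ F cutPlane)
    (hs : ∀ w, ‖w‖ < 1 → F w = ₂F₁ a b c w) {z : ℂ} (hz : z ∈ cutPlane) :
    gaussHypergeometric a b c z = F z := by
  have h : ∃ F : ℂ → ℂ, AnalyticOnNhd ℂ F cutPlane ∧ ∀ w, ‖w‖ < 1 → F w = ₂F₁ a b c w :=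
    ⟨F, hF, hs⟩
  rw [gaussHypergeometric, dif_pos h]
  refine h.choose_spec.1.eqOn_of_preconnected_of_eventuallyEq hF isPreconnected_cutPlane
    (z₀ := 0) (by simp [cutPlane]) ?_ hz
  filter_upwards [Metric.ball_mem_nhds (0 : ℂ) one_pos] with w hw
  have hw' : ‖w‖ < 1 := by simpa using hw
  rw [h.choose_spec.2 w hw', hs w hw']

/-!
Write `K x = x ^ (σ - 1) * E^γ_{α,σ}(-x ^ α)`, so that the Lévy density is a positive constant times
`x⁻¹ * K x`. For `s > 1` the series of `E` can be integrated term by term and the binomial series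
gives the Laplace transform `F s = s ^ (αγ - σ) * (1 + s ^ α) ^ (-γ)` of `K`
(`laplace_prabhakarKernel_of_one_lt`).

*Positivity.* Each of the factors `s ^ (-(σ - αγ))` and `(1 + s ^ α) ^ (-γ)` is a completely
monotone function of `s`, because `αγ ≤ σ` and `α ≤ 1`. Only the values at the integers `s ≥ 2` are
needed, and complete monotonicity is used in the form of nonnegative finite differences, which is
stable under products, mixtures and pointwise limits (`IsCM`). The differences of `F` at the
integers are the integrals of `exp (-2 x) * K x` against the Bernstein polynomials in `exp (-x)`;
as these are nonnegative, so is the continuous function `K` (`nonneg_of_isCM`).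

*Laplace transform near zero.* Since `K ≥ 0` and `F` is holomorphic in the right half-plane, the
Laplace transform of `K` converges and equals `F` for all `s > 0`, by the argument of Landau's
theorem (`lintegral_laplace_eq_of_differentiableOn`). Integrating over `(0, s]` with Tonelli yields
`∫ (1 - exp (-s x)) ν(dx)` as a multiple of `∫ u in (0, s], F u`
(`lintegral_one_sub_exp_prabhakarLevyMeasure`). It is finite because `αγ - σ > -1`, so `ν` is the
Lévy measure of a subordinator, and the substitution `u = s t ^ (1 / α)` turns it into Euler's
integral for `₂F₁(γ, b; b + 1; -s ^ α)` with `b = γ + (1 - σ) / α`, which is the analytic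
continuation of the series to the cut plane (`gaussHypergeometric_eq_eulerIntegral`).

*The law of `X 1`.* The process is only given through its characteristic function. Both sides of
the Lévy–Khintchine formula extend to bounded holomorphic functions on a half-plane, continuous up
to the boundary, where they agree; by the Phragmén–Lindelöf principle they agree on the half-plane,
in particular on the half-line that gives the Laplace transform
(`integral_cexp_neg_mul_eq_exp_laplaceExponent`).
-/

/-! ### Completely monotone sequences -/

/-- The negated forward difference `a k - a (k + 1)` of a real sequence. -/
def negDiff (a : ℕ → ℝ) (k : ℕ) : ℝ := a k - a (k + 1)

/-- A real sequence is completely monotone if all its iterated negated forward differences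
are nonnegative. -/
def IsCM (a : ℕ → ℝ) : Prop := ∀ n k, 0 ≤ (negDiff^[n] a) k

theorem negDiff_iterate_succ (a : ℕ → ℝ) (n k : ℕ) :
    (negDiff^[n + 1] a) k = (negDiff^[n] a) k - (negDiff^[n] a) (k + 1) := by
  rw [Function.iterate_succ_apply']; rfl

theorem negDiff_iterate_add (a b : ℕ → ℝ) (n k : ℕ) :
    (negDiff^[n] (fun j => a j + b j)) k = (negDiff^[n] a) k + (negDiff^[n] b) k := by
  induction n generalizing k with
  | zero => rfl
  | succ n ih => simp only [negDiff_iterate_succ, ih]; ring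

theorem negDiff_iterate_const_mul (c : ℝ) (a : ℕ → ℝ) (n k : ℕ) :
    (negDiff^[n] (fun j => c * a j)) k = c * (negDiff^[n] a) k := by
  induction n generalizing k with
  | zero => rfl
  | succ n ih => simp only [negDiff_iterate_succ, ih]; ring

theorem negDiff_iterate_pow (y : ℝ) (n k : ℕ) :
    (negDiff^[n] (fun j => y ^ j)) k = y ^ k * (1 - y) ^ n := by
  induction n generalizing k with
  | zero => simp
  | succ n ih => simp only [negDiff_iterate_succ, ih]; ring

theorem negDiff_iterate_shift (a : ℕ → ℝ) (n k : ℕ) :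
    (negDiff^[n] (fun j => a (j + 1))) k = (negDiff^[n] a) (k + 1) := by
  induction n generalizing k with
  | zero => rfl
  | succ n ih => simp only [negDiff_iterate_succ, ih]

theorem negDiff_iterate_tendsto {ι : Type*} {l : Filter ι} {a : ι → ℕ → ℝ} {b : ℕ → ℝ}
    (h : ∀ k, Tendsto (fun i => a i k) l (𝓝 (b k))) (n k : ℕ) :
    Tendsto (fun i => (negDiff^[n] (a i)) k) l (𝓝 ((negDiff^[n] b) k)) := by
  induction n generalizing k with
  | zero => exact h k
  | succ n ih => simp only [negDiff_iterate_succ]; exact (ih k).sub (ih (k + 1))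

theorem negDiff_iterate_integral {T : Type*} [MeasurableSpace T] {μ : Measure T} {g : T → ℕ → ℝ}
    (hg : ∀ k, Integrable (fun t => g t k) μ) (n k : ℕ) :
    Integrable (fun t => (negDiff^[n] (g t)) k) μ ∧
      (negDiff^[n] (fun j => ∫ t, g t j ∂μ)) k = ∫ t, (negDiff^[n] (g t)) k ∂μ := by
  induction n generalizing k with
  | zero => exact ⟨hg k, rfl⟩
  | succ n ih =>
    simp only [negDiff_iterate_succ]
    refine ⟨(ih k).1.sub (ih (k + 1)).1, ?_⟩
    rw [(ih k).2, (ih (k + 1)).2, integral_sub (ih k).1 (ih (k + 1)).1]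

namespace IsCM

theorem pow {y : ℝ} (h0 : 0 ≤ y) (h1 : y ≤ 1) : IsCM (fun k => y ^ k) := fun n k => by
  rw [negDiff_iterate_pow]
  have := sub_nonneg.2 h1
  positivity

theorem add {a b : ℕ → ℝ} (ha : IsCM a) (hb : IsCM b) : IsCM (fun k => a k + b k) := fun n k => by
  rw [negDiff_iterate_add]
  exact add_nonneg (ha n k) (hb n k)

theorem const_mul {a : ℕ → ℝ} {c : ℝ} (hc : 0 ≤ c) (ha : IsCM a) : IsCM (fun k => c * a k) :=
  fun n k => by
    rw [negDiff_iterate_const_mul]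
    exact mul_nonneg hc (ha n k)

theorem of_tendsto {ι : Type*} {l : Filter ι} [l.NeBot] {a : ι → ℕ → ℝ} {b : ℕ → ℝ}
    (ha : ∀ i, IsCM (a i)) (h : ∀ k, Tendsto (fun i => a i k) l (𝓝 (b k))) : IsCM b := fun n k =>
  ge_of_tendsto' (negDiff_iterate_tendsto h n k) fun i => ha i n k

theorem integral {T : Type*} [MeasurableSpace T] {μ : Measure T} {g : T → ℕ → ℝ}
    (hg : ∀ k, Integrable (fun t => g t k) μ) (hcm : ∀ᵐ t ∂μ, IsCM (g t)) :
    IsCM (fun k => ∫ t, g t k ∂μ) := fun n k => by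
  rw [(negDiff_iterate_integral hg n k).2]
  refine integral_nonneg_of_ae ?_
  filter_upwards [hcm] with t ht using ht n k

/-- The Leibniz rule `Δ(ab) = Δa · b + a(· + 1) · Δb` reduces the order of the difference. -/
theorem mul {a b : ℕ → ℝ} (ha : IsCM a) (hb : IsCM b) : IsCM (fun k => a k * b k) := by
  intro n
  induction n generalizing a b with
  | zero => exact fun k => mul_nonneg (ha 0 k) (hb 0 k)
  | succ n ih =>
    intro k
    have hd : ∀ {c : ℕ → ℝ}, IsCM c → IsCM (negDiff c) := fun hc m j => by
      rw [← Function.iterate_succ_apply]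
      exact hc (m + 1) j
    have hs : IsCM (fun j => a (j + 1)) := fun m j => by
      rw [negDiff_iterate_shift]
      exact ha m (j + 1)
    have e : negDiff (fun j => a j * b j) =
        fun j => negDiff a j * b j + a (j + 1) * negDiff b j := by
      funext j
      simp only [negDiff]
      ring
    rw [Function.iterate_succ_apply, e, negDiff_iterate_add]
    exact add_nonneg (ih (hd ha) hb k) (ih hs (hd hb) k)

theorem const {c : ℝ} (hc : 0 ≤ c) : IsCM (fun _ => c) := by
  simpa using (pow zero_le_one le_rfl).const_mul hc

theorem npow {a : ℕ → ℝ} (ha : IsCM a) (m : ℕ) : IsCM (fun k => a k ^ m) := by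
  induction m with
  | zero => simpa using const zero_le_one
  | succ m ih => simpa only [pow_succ] using ih.mul ha

theorem sum {ι : Type*} (s : Finset ι) {a : ι → ℕ → ℝ} (ha : ∀ i, IsCM (a i)) :
    IsCM (fun k => ∑ i ∈ s, a i k) := by
  classical
  induction s using Finset.induction_on with
  | empty => simpa using const le_rfl
  | insert i s hi ih => simpa only [Finset.sum_insert hi] using (ha i).add ih

theorem exp {a : ℕ → ℝ} (ha : IsCM a) : IsCM (fun k => Real.exp (a k)) := by
  refine of_tendsto (l := atTop)
    (a := fun N k => ∑ m ∈ Finset.range N, (m.factorial : ℝ)⁻¹ * a k ^ m)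
    (fun N => sum _ fun m => (ha.npow m).const_mul (by positivity)) fun k => ?_
  have := (NormedSpace.expSeries_div_hasSum_exp (a k)).tendsto_sum_nat
  rw [← Real.exp_eq_exp_ℝ] at this
  simpa only [div_eq_inv_mul] using this

end IsCM

theorem integrableOn_rpow_sub_one_mul_exp_neg_mul {a r : ℝ} (ha : 0 < a) (hr : 0 < r) :
    IntegrableOn (fun u : ℝ => u ^ (a - 1) * Real.exp (-(r * u))) (Set.Ioi 0) := by
  have := integrableOn_rpow_mul_exp_neg_mul_rpow (s := a - 1) (p := 1) (b := r) (by linarith)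
    one_pos hr
  simpa using this

theorem rpow_neg_eq_integral {a r : ℝ} (ha : 0 < a) (hr : 0 < r) :
    r ^ (-a) = (Real.Gamma a)⁻¹ * ∫ u in Set.Ioi 0, u ^ (a - 1) * Real.exp (-(r * u)) := by
  rw [Real.integral_rpow_mul_exp_neg_mul_Ioi ha hr, one_div, Real.inv_rpow hr.le,
    Real.rpow_neg hr.le,
    mul_comm, mul_assoc, mul_inv_cancel₀ (Real.Gamma_pos_of_pos ha).ne', mul_one]

/-- Negative powers are mixtures of exponentials. -/
theorem IsCM.rpow_neg {a c : ℝ} (ha : 0 ≤ a) (hc : 0 < c) : IsCM (fun k : ℕ => (k + c) ^ (-a)) := by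
  rcases ha.eq_or_lt with rfl | ha
  · simpa using IsCM.const zero_le_one
  have hp : ∀ k : ℕ, 0 < k + c := fun k => by positivity
  simp only [fun k : ℕ => rpow_neg_eq_integral ha (hp k)]
  refine IsCM.const_mul (by have := Real.Gamma_pos_of_pos ha; positivity) ?_
  refine IsCM.integral (fun k => integrableOn_rpow_sub_one_mul_exp_neg_mul ha (hp k)) ?_
  refine ae_restrict_of_forall_mem measurableSet_Ioi fun u (hu : 0 < u) => ?_
  have := ((IsCM.pow (Real.exp_pos (-u)).le (Real.exp_le_one_iff.2 (by linarith))).const_mul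
    (c := u ^ (a - 1) * Real.exp (-(c * u))) (by positivity))
  convert this using 2 with k
  rw [mul_assoc, ← Real.exp_nat_mul, ← Real.exp_add]
  ring_nf

open Real in
/-- The functions `s ↦ exp (-τ s ^ α)` are completely monotone: `s ^ α` is an increasing limit of
constants minus mixtures of the completely monotone functions `(t + s)⁻¹`. -/
theorem IsCM.exp_neg_rpow {α τ c : ℝ} (hα0 : 0 < α) (hα1 : α ≤ 1) (hτ : 0 ≤ τ) (hc : 0 < c) :
    IsCM (fun k : ℕ => Real.exp (-(τ * (k + c) ^ α))) := by
  rcases hα1.eq_or_lt with rfl | hα1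
  · have := ((IsCM.pow (Real.exp_pos (-τ)).le (Real.exp_le_one_iff.2 (by linarith))).const_mul
      (c := Real.exp (-(τ * c))) (by positivity))
    convert this using 2 with k
    rw [← Real.exp_nat_mul, ← Real.exp_add, Real.rpow_one]
    ring_nf
  have hα : α ∈ Set.Ioo (0 : ℝ) 1 := ⟨hα0, hα1⟩
  set C : ℝ := (∫ t in Set.Ioi 0, rpowIntegrand₀₁ α t 1)⁻¹
  have hC : 0 < C := inv_pos.2 (integral_rpowIntegrand₀₁_one_pos hα)
  have hlim : ∀ k : ℕ, Tendsto
      (fun N : ℕ => Real.exp (-(τ * (C * ∫ t in Set.Ioc 0 (N : ℝ), rpowIntegrand₀₁ α t (k + c)))))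
      atTop (𝓝 (Real.exp (-(τ * (k + c) ^ α)))) := by
    intro k
    have hk : (0 : ℝ) ≤ k + c := by positivity
    rw [rpow_eq_const_mul_integral hα hk]
    refine (Real.continuous_exp.tendsto _).comp ((Tendsto.const_mul _ (Tendsto.const_mul _ ?_)).neg)
    have := intervalIntegral_tendsto_integral_Ioi 0 (integrableOn_rpowIntegrand₀₁_Ioi hα hk)
      tendsto_natCast_atTop_atTop
    refine this.congr fun N => ?_
    rw [intervalIntegral.integral_of_le (by positivity)]
  refine IsCM.of_tendsto (l := atTop) (fun N => ?_) hlim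
  have hint : ∀ k : ℕ, IntegrableOn (fun t => t ^ α * ((t : ℝ) + (k + c))⁻¹)
      (Set.Ioc 0 (N : ℝ)) := by
    intro k
    have hk : (0 : ℝ) < k + c := by positivity
    refine IntegrableOn.mono_set (t := Set.Icc 0 (N : ℝ)) ?_ Set.Ioc_subset_Icc_self
    refine ContinuousOn.integrableOn_Icc (ContinuousOn.mul ?_ ?_)
    · exact (Real.continuous_rpow_const hα0.le).continuousOn
    · refine ContinuousOn.inv₀ (by fun_prop) fun t ht => ?_
      have := ht.1
      positivity
  have hint2 : IntegrableOn (fun t : ℝ => t ^ (α - 1)) (Set.Ioc 0 (N : ℝ)) := by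
    have := intervalIntegral.intervalIntegrable_rpow' (a := 0) (b := N) (r := α - 1) (by linarith)
    rwa [intervalIntegrable_iff_integrableOn_Ioc_of_le (by positivity)] at this
  have hg : IsCM (fun k : ℕ => ∫ t in Set.Ioc 0 (N : ℝ), t ^ α * (t + (k + c))⁻¹) := by
    refine IsCM.integral hint ?_
    refine ae_restrict_of_forall_mem measurableSet_Ioc fun t ht => ?_
    have := (IsCM.rpow_neg (a := 1) (c := t + c) zero_le_one (by linarith [ht.1])).const_mul
      (c := t ^ α) (Real.rpow_nonneg ht.1.le _)
    convert this using 3 with k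
    rw [Real.rpow_neg_one]
    ring_nf
  have e : ∀ k : ℕ, ∫ t in Set.Ioc 0 (N : ℝ), rpowIntegrand₀₁ α t (k + c) =
      (∫ t in Set.Ioc 0 (N : ℝ), t ^ (α - 1)) -
        ∫ t in Set.Ioc 0 (N : ℝ), t ^ α * (t + (k + c))⁻¹ := by
    intro k
    rw [← integral_sub hint2 (hint k)]
    refine setIntegral_congr_fun measurableSet_Ioc fun t ht => ?_
    simp only [rpowIntegrand₀₁_eq_sub hα1.ne ht.1]
  have := ((hg.const_mul (mul_nonneg hτ hC.le)).exp).const_mul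
    (c := Real.exp (-(τ * C * ∫ t in Set.Ioc 0 (N : ℝ), t ^ (α - 1)))) (by positivity)
  convert this using 2 with k
  rw [e, ← Real.exp_add]
  congr 1
  ring

/-- The power `(1 + s ^ α) ^ (-γ)` is a mixture over `u` of the functions `exp (-u s ^ α)`, with
the Gamma density as weight. -/
theorem IsCM.one_add_rpow_rpow_neg {α γ c : ℝ} (hα0 : 0 < α) (hα1 : α ≤ 1) (hγ : 0 < γ)
    (hc : 0 < c) : IsCM (fun k : ℕ => (1 + ((k : ℝ) + c) ^ α) ^ (-γ)) := by
  have hp : ∀ k : ℕ, 0 < 1 + ((k : ℝ) + c) ^ α := fun k => by positivity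
  simp only [fun k : ℕ => rpow_neg_eq_integral hγ (hp k)]
  refine IsCM.const_mul (by have := Real.Gamma_pos_of_pos hγ; positivity) ?_
  refine IsCM.integral (fun k => integrableOn_rpow_sub_one_mul_exp_neg_mul hγ (hp k)) ?_
  refine ae_restrict_of_forall_mem measurableSet_Ioi fun u (hu : 0 < u) => ?_
  have := (IsCM.exp_neg_rpow hα0 hα1 hu.le hc).const_mul
    (c := u ^ (γ - 1) * Real.exp (-u)) (by positivity)
  convert this using 2 with k
  rw [mul_assoc, ← Real.exp_add]
  ring_nf

/-! ### Positivity from a completely monotone moment sequence -/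

section Bernstein

open scoped unitInterval

/-- The point `exp (-x)` of the unit interval (for `0 ≤ x`). -/
noncomputable def expNegI (x : ℝ) : I := Set.projIcc 0 1 zero_le_one (Real.exp (-x))

theorem continuous_expNegI : Continuous expNegI := by
  unfold expNegI
  fun_prop

theorem coe_expNegI {x : ℝ} (hx : 0 < x) : (expNegI x : ℝ) = Real.exp (-x) := by
  rw [expNegI, Set.projIcc_of_mem zero_le_one
    ⟨(Real.exp_pos _).le, Real.exp_le_one_iff.2 (by linarith)⟩]

theorem integrableOn_mul_comp_expNegI {w : ℝ → ℝ} (hw : IntegrableOn w (Set.Ioi 0)) (φ : C(I, ℝ)) :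
    IntegrableOn (fun x => w x * φ (expNegI x)) (Set.Ioi 0) := by
  refine Integrable.mul_bdd (c := ‖φ‖) hw ?_ (Eventually.of_forall fun x => φ.norm_coe_le_norm _)
  exact (φ.continuous.comp continuous_expNegI).aestronglyMeasurable

theorem integral_mul_bernstein_nonneg {w : ℝ → ℝ} (hw : IntegrableOn w (Set.Ioi 0))
    (hcm : IsCM fun k => ∫ x in Set.Ioi 0, w x * Real.exp (-x) ^ k) (n ν : ℕ) :
    0 ≤ ∫ x in Set.Ioi 0, w x * bernstein n ν (expNegI x) := by
  have hint : ∀ k : ℕ, IntegrableOn (fun x => w x * Real.exp (-x) ^ k) (Set.Ioi 0) := by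
    intro k
    refine (integrableOn_mul_comp_expNegI hw ⟨fun y : I => (y : ℝ) ^ k, by fun_prop⟩).congr_fun
      (fun x hx => ?_) measurableSet_Ioi
    simp [coe_expNegI hx]
  have h := hcm (n - ν) ν
  rw [(negDiff_iterate_integral hint _ _).2] at h
  have e : ∀ x, (negDiff^[n - ν] fun k => w x * Real.exp (-x) ^ k) ν =
      w x * (Real.exp (-x) ^ ν * (1 - Real.exp (-x)) ^ (n - ν)) := fun x => by
    rw [negDiff_iterate_const_mul, negDiff_iterate_pow]
  simp only [e] at h
  have e2 : ∫ x in Set.Ioi 0, w x * bernstein n ν (expNegI x) = (n.choose ν : ℝ) *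
      ∫ x in Set.Ioi 0, w x * (Real.exp (-x) ^ ν * (1 - Real.exp (-x)) ^ (n - ν)) := by
    rw [← integral_const_mul]
    refine setIntegral_congr_fun measurableSet_Ioi fun x hx => ?_
    simp only [bernstein_apply, coe_expNegI hx]
    ring
  rw [e2]
  positivity

theorem integral_mul_comp_expNegI_nonneg {w : ℝ → ℝ} (hw : IntegrableOn w (Set.Ioi 0))
    (hcm : IsCM fun k => ∫ x in Set.Ioi 0, w x * Real.exp (-x) ^ k) {φ : C(I, ℝ)}
    (hφ : ∀ y, 0 ≤ φ y) :
    0 ≤ ∫ x in Set.Ioi 0, w x * φ (expNegI x) := by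
  have hlim : Tendsto
      (fun n => ∫ x in Set.Ioi 0, w x * bernsteinApproximation n φ (expNegI x)) atTop
      (𝓝 (∫ x in Set.Ioi 0, w x * φ (expNegI x))) := by
    have hu := bernsteinApproximation_uniform φ
    refine tendsto_integral_filter_of_dominated_convergence (fun x => ‖w x‖ * (‖φ‖ + 1))
      (Eventually.of_forall fun n => (integrableOn_mul_comp_expNegI hw _).aestronglyMeasurable) ?_
      (hw.norm.mul_const _) (Eventually.of_forall fun x => ?_)
    · have : ∀ᶠ n in atTop, ‖bernsteinApproximation n φ‖ < ‖φ‖ + 1 :=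
        hu.norm.eventually (gt_mem_nhds (by linarith))
      filter_upwards [this] with n hn
      refine Eventually.of_forall fun x => ?_
      rw [norm_mul]
      gcongr
      exact (ContinuousMap.norm_coe_le_norm _ _).trans hn.le
    · exact Tendsto.const_mul _ (((continuous_eval_const (expNegI x)).tendsto φ).comp hu)
  refine ge_of_tendsto' hlim fun n => ?_
  simp only [bernsteinApproximation.apply, Finset.mul_sum, smul_eq_mul]
  rw [integral_finsetSum _ fun k _ => ?_]
  · refine Finset.sum_nonneg fun k _ => ?_
    have e : ∀ x, w x * (bernstein n k (expNegI x) * φ (bernstein.z k)) =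
      φ (bernstein.z k) * (w x * bernstein n k (expNegI x)) := fun x => by ring
    simp only [e]
    rw [integral_const_mul]
    exact mul_nonneg (hφ _) (integral_mul_bernstein_nonneg hw hcm n k)
  · have := (integrableOn_mul_comp_expNegI hw (bernstein n k)).mul_const (φ (bernstein.z k))
    simpa only [mul_assoc] using this

/-- A continuous integrable function on `(0, ∞)` whose moments against the powers of `exp (-x)`
are completely monotone is nonnegative: its integrals against nonnegative continuous functions of
`exp (-x)` are nonnegative, by approximation with Bernstein polynomials. -/
theorem nonneg_of_isCM {w : ℝ → ℝ} (hw : IntegrableOn w (Set.Ioi 0))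
    (hc : ContinuousOn w (Set.Ioi 0))
    (hcm : IsCM fun k => ∫ x in Set.Ioi 0, w x * Real.exp (-x) ^ k) {x₀ : ℝ} (hx₀ : 0 < x₀) :
    0 ≤ w x₀ := by
  by_contra! hneg
  have hnhds : ∀ᶠ x in 𝓝 x₀, 0 < x ∧ w x < 0 :=
    (eventually_gt_nhds hx₀).and
      ((hc.continuousAt (Ioi_mem_nhds hx₀)).eventually (gt_mem_nhds hneg))
  -- The exponential is a homeomorphism, so `w < 0` wherever `exp (-x)` is close to `exp (-x₀)`.
  have hnhds' : ∀ᶠ y in 𝓝 (Real.exp (-x₀)), 0 < -Real.log y ∧ w (-Real.log y) < 0 := by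
    have : Tendsto (fun y => -Real.log y) (𝓝 (Real.exp (-x₀))) (𝓝 x₀) := by
      have h : ContinuousAt (fun y => -Real.log y) (Real.exp (-x₀)) :=
        (Real.continuousAt_log (Real.exp_pos (-x₀)).ne').neg
      simpa only [ContinuousAt, Real.log_exp, neg_neg] using h
    exact this.eventually hnhds
  obtain ⟨δ, hδ, hball⟩ := Metric.eventually_nhds_iff.1 hnhds'
  set φ : C(I, ℝ) := ⟨fun y => max 0 (δ - |(y : ℝ) - Real.exp (-x₀)|), by fun_prop⟩ with hφ
  have hφ0 : ∀ y, 0 ≤ φ y := fun y => le_max_left _ _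
  have hle : ∀ x ∈ Set.Ioi (0 : ℝ), w x * φ (expNegI x) ≤ 0 := by
    intro x hx
    by_cases hd : |Real.exp (-x) - Real.exp (-x₀)| < δ
    · have := (hball (y := Real.exp (-x)) (by rwa [Real.dist_eq])).2
      rw [Real.log_exp, neg_neg] at this
      exact mul_nonpos_of_nonpos_of_nonneg this.le (hφ0 _)
    · have : φ (expNegI x) = 0 := by
        simp only [hφ, ContinuousMap.coe_mk, coe_expNegI hx]
        exact max_eq_left (by linarith [not_lt.1 hd])
      simp [this]
  have hI := integrableOn_mul_comp_expNegI hw φ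
  have h0 : ∫ x in Set.Ioi 0, -(w x * φ (expNegI x)) = 0 := by
    refine le_antisymm ?_ (setIntegral_nonneg measurableSet_Ioi fun x hx => neg_nonneg.2 (hle x hx))
    rw [integral_neg]
    exact neg_nonpos.2 (integral_mul_comp_expNegI_nonneg hw hcm hφ0)
  rw [setIntegral_eq_zero_iff_of_nonneg_ae
    (ae_restrict_of_forall_mem measurableSet_Ioi fun x hx => neg_nonneg.2 (hle x hx)) hI.neg] at h0
  have hcont : ContinuousOn (fun x => -(w x * φ (expNegI x))) (Set.Ioi 0) :=
    (hc.mul (φ.continuous.comp continuous_expNegI).continuousOn).neg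
  have hz := Measure.eqOn_of_ae_eq h0 hcont continuousOn_const
    (by rw [interior_Ioi]; exact subset_closure) hx₀
  have h1 : φ (expNegI x₀) = δ := by
    simp only [hφ, ContinuousMap.coe_mk, coe_expNegI hx₀]
    simp [hδ.le]
  simp only [h1, Pi.zero_apply, neg_eq_zero, mul_eq_zero] at hz
  rcases hz with hz | hz <;> linarith

end Bernstein

/-! ### The binomial series -/

/-- The coefficient `(γ)_k / k!` of the binomial series of `(1 - z) ^ (-γ)`. -/
noncomputable def binomCoeff (γ : ℝ) (k : ℕ) : ℝ := (ascPochhammer ℝ k).eval γ / k.factorial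

theorem binomCoeff_nonneg {γ : ℝ} (hγ : 0 < γ) (k : ℕ) : 0 ≤ binomCoeff γ k :=
  div_nonneg (ascPochhammer_pos k γ hγ).le (by positivity)

theorem ofReal_ascPochhammer_eval (γ : ℝ) (k : ℕ) :
    (((ascPochhammer ℝ k).eval γ : ℝ) : ℂ) = (ascPochhammer ℂ k).eval (γ : ℂ) := by
  induction k with
  | zero => simp
  | succ k ih => simp only [ascPochhammer_succ_eval, Complex.ofReal_mul, ih]; push_cast; rfl

theorem Real.Gamma_nat_add_eq {γ : ℝ} (hγ : 0 < γ) (k : ℕ) :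
    Real.Gamma (k + γ) = Real.Gamma γ * (ascPochhammer ℝ k).eval γ := by
  induction k with
  | zero => simp
  | succ k ih =>
    rw [ascPochhammer_succ_eval, ← mul_assoc, ← ih, mul_comm,
      show ((k + 1 : ℕ) : ℝ) + γ = (k + γ) + 1 by push_cast; ring,
      Real.Gamma_add_one (by positivity)]
    ring

theorem hasSum_binomCoeff_cpow (γ : ℝ) {z : ℂ} (hz : ‖z‖ < 1) :
    HasSum (fun k => (binomCoeff γ k : ℂ) * z ^ k) ((1 - z) ^ (-(γ : ℂ))) := by
  have h := (Complex.one_add_cpow_hasFPowerSeriesOnBall_zero (a := -(γ : ℂ))).hasSum (y := -z)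
    (by simpa [enorm_eq_nnnorm, ← NNReal.coe_lt_coe] using hz)
  rw [binomialSeries_eq_ordinaryHypergeometricSeries (b := (1 : ℂ))
    (fun k => by norm_cast), neg_neg] at h
  have e1 : (1 + (0 + -z)) = 1 - z := by ring
  rw [e1] at h
  refine h.congr_fun fun k => ?_
  simp only [FormalMultilinearSeries.compContinuousLinearMap_apply, Function.comp_def]
  have : (-ContinuousLinearMap.id ℂ ℂ) (-z) = z := by simp
  simp only [this, ordinaryHypergeometricSeries_apply_eq, smul_eq_mul]
  have h1 : (ascPochhammer ℂ k).eval 1 ≠ 0 := by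
    rw [ascPochhammer_eval_one]
    exact_mod_cast k.factorial_ne_zero
  rw [mul_inv_cancel_right₀ h1, binomCoeff, Complex.ofReal_div, ofReal_ascPochhammer_eval]
  push_cast
  ring

theorem hasSum_binomCoeff_rpow (γ : ℝ) {x : ℝ} (hx : |x| < 1) :
    HasSum (fun k => binomCoeff γ k * x ^ k) ((1 - x) ^ (-γ)) := by
  have h := hasSum_binomCoeff_cpow γ (z := (x : ℂ)) (by simpa using hx)
  have hx' : 0 ≤ 1 - x := by linarith [(abs_lt.1 hx).2]
  have e : (1 - (x : ℂ)) ^ (-(γ : ℂ)) = (((1 - x) ^ (-γ) : ℝ) : ℂ) := by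
    rw [Complex.ofReal_cpow hx']
    push_cast
    rfl
  rw [e] at h
  exact_mod_cast h

/-! ### The Prabhakar function and its Laplace transform -/

/-- Restricting the Gamma integral to `(A, A + 1]` bounds it below by a power of `A`, for every
`A`. -/
theorem rpow_le_mul_Gamma {A y : ℝ} (hA : 0 < A) (hy : 1 ≤ y) :
    A ^ (y - 1) ≤ Real.exp (A + 1) * Real.Gamma y := by
  rw [Real.Gamma_eq_integral (by linarith)]
  have hint := Real.GammaIntegral_convergent (s := y) (by linarith)
  have h1 : Real.exp (-(A + 1)) * A ^ (y - 1) ≤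
      ∫ x in Set.Ioc A (A + 1), Real.exp (-x) * x ^ (y - 1) := by
    have := setIntegral_mono_on (μ := volume) (s := Set.Ioc A (A + 1))
      (f := fun _ => Real.exp (-(A + 1)) * A ^ (y - 1))
      (integrableOn_const (by simp)) (hint.mono_set fun x hx => hA.trans hx.1) measurableSet_Ioc
      (fun x hx => mul_le_mul (Real.exp_le_exp.2 (by linarith [hx.2]))
        (Real.rpow_le_rpow hA.le hx.1.le (by linarith)) (by positivity) (by positivity))
    simpa using this
  have h2 : ∫ x in Set.Ioc A (A + 1), Real.exp (-x) * x ^ (y - 1) ≤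
      ∫ x in Set.Ioi 0, Real.exp (-x) * x ^ (y - 1) := by
    refine setIntegral_mono_set hint ?_ (Eventually.of_forall fun x hx => hA.trans hx.1)
    refine ae_restrict_of_forall_mem measurableSet_Ioi fun x (hx : 0 < x) => ?_
    simp only [Pi.zero_apply]
    positivity
  calc A ^ (y - 1) = Real.exp (A + 1) * (Real.exp (-(A + 1)) * A ^ (y - 1)) := by
        rw [← mul_assoc, ← Real.exp_add]; simp
    _ ≤ _ := by gcongr; exact h1.trans h2

theorem prabhakarE_eq_tsum {α σ γ : ℝ} (hγ : 0 < γ) (z : ℝ) :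
    prabhakarE α σ γ z = ∑' k : ℕ, binomCoeff γ k * z ^ k / Real.Gamma (α * k + σ) := by
  rw [prabhakarE, ← tsum_mul_left]
  refine tsum_congr fun k => ?_
  have := (Real.Gamma_pos_of_pos hγ).ne'
  have := k.factorial_ne_zero
  rw [Real.Gamma_nat_add_eq hγ, binomCoeff]
  field_simp

/-- The Gamma function grows faster than any geometric sequence, so the Prabhakar series is
entire. -/
theorem summable_prabhakar {α σ γ : ℝ} (hα : 0 < α) (hγ : 0 < γ) (hσ : 1 ≤ σ) {r : ℝ}
    (hr : 0 < r) : Summable fun k : ℕ => binomCoeff γ k * r ^ k / Real.Gamma (α * k + σ) := by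
  -- `A` is chosen so that `r / A ^ α = 1 / 2`.
  set A : ℝ := (2 * r) ^ α⁻¹
  have hA : 0 < A := by positivity
  have hAα : A ^ α = 2 * r := by
    rw [← Real.rpow_mul (by positivity), inv_mul_cancel₀ hα.ne', Real.rpow_one]
  have hs := ((hasSum_binomCoeff_rpow γ (x := 1 / 2) (by norm_num [abs_lt])).summable).mul_left
    (Real.exp (A + 1) * A ^ (1 - σ))
  refine Summable.of_nonneg_of_le (fun k => ?_) (fun k => ?_) hs
  · have := binomCoeff_nonneg hγ k
    have := (Real.Gamma_pos_of_pos (s := α * k + σ) (by positivity)).le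
    positivity
  · have hk : 0 ≤ α * k := by positivity
    have hG := Real.Gamma_pos_of_pos (s := α * k + σ) (by linarith)
    have h := rpow_le_mul_Gamma hA (y := α * k + σ) (by linarith)
    have e : A ^ (α * k + σ - 1) = (2 * r) ^ k * A ^ (σ - 1) := by
      rw [add_sub_assoc, Real.rpow_add hA, Real.rpow_mul hA.le, hAα, Real.rpow_natCast]
    have e2 : A ^ (1 - σ) * A ^ (σ - 1) = 1 := by
      rw [← Real.rpow_add hA]; simp
    rw [e] at h
    have hp : 0 < A ^ (1 - σ) := by positivity
    rw [div_le_iff₀ hG]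
    have hc : 0 ≤ binomCoeff γ k * (1 / 2) ^ k * A ^ (1 - σ) :=
      mul_nonneg (mul_nonneg (binomCoeff_nonneg hγ k) (by positivity)) hp.le
    have h' := mul_le_mul_of_nonneg_left h hc
    calc binomCoeff γ k * r ^ k
        = binomCoeff γ k * ((1 / 2) ^ k * (2 * r) ^ k) * (A ^ (1 - σ) * A ^ (σ - 1)) := by
          rw [e2, ← mul_pow]; simp
      _ = binomCoeff γ k * (1 / 2) ^ k * A ^ (1 - σ) * ((2 * r) ^ k * A ^ (σ - 1)) := by ring
      _ ≤ _ := h'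
      _ = _ := by ring

theorem continuous_prabhakarE {α σ γ : ℝ} (hα : 0 < α) (hγ : 0 < γ) (hσ : 1 ≤ σ) :
    Continuous (prabhakarE α σ γ) := by
  rw [continuous_iff_continuousAt]
  intro z
  have h : ContinuousOn (prabhakarE α σ γ) (Metric.ball 0 (|z| + 1)) := by
    rw [funext (prabhakarE_eq_tsum (α := α) (σ := σ) hγ)]
    refine continuousOn_tsum (fun k => by fun_prop)
      (summable_prabhakar hα hγ hσ (r := |z| + 1) (by positivity)) fun k x hx => ?_
    have := binomCoeff_nonneg hγ k
    have hG := Real.Gamma_pos_of_pos (s := α * k + σ) (by positivity)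
    have hx' : |x| ≤ |z| + 1 := by
      rw [mem_ball_zero_iff, Real.norm_eq_abs] at hx
      exact hx.le
    rw [norm_div, norm_mul, Real.norm_of_nonneg this, Real.norm_of_nonneg hG.le, norm_pow,
      Real.norm_eq_abs]
    gcongr
  exact h.continuousAt (Metric.isOpen_ball.mem_nhds (by simp))

theorem integrable_tsum_of_summable_integral_norm {X : Type*} [MeasurableSpace X] {μ : Measure X}
    {F : ℕ → X → ℝ} (hF : ∀ i, Integrable (F i) μ) (hs : Summable fun i => ∫ x, ‖F i x‖ ∂μ)
    (hm : AEStronglyMeasurable (fun x => ∑' i, F i x) μ) : Integrable (fun x => ∑' i, F i x) μ := by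
  refine ⟨hm, ?_⟩
  calc ∫⁻ x, ‖∑' i, F i x‖ₑ ∂μ ≤ ∫⁻ x, ∑' i, ‖F i x‖ₑ ∂μ :=
        lintegral_mono fun x => enorm_tsum_le_tsum_enorm
    _ = ∑' i, ENNReal.ofReal (∫ x, ‖F i x‖ ∂μ) := by
        rw [lintegral_tsum fun i => (hF i).1.enorm]
        exact tsum_congr fun i => (ofReal_integral_norm_eq_lintegral_enorm (hF i)).symm
    _ < ∞ := hs.tsum_ofReal_lt_top

/-- The function `x ^ (σ - 1) E^γ_{α,σ}(-x ^ α)`, whose Laplace transform is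
`s ^ (αγ - σ) (1 + s ^ α) ^ (-γ)`. -/
noncomputable def prabhakarKernel (α σ γ x : ℝ) : ℝ := x ^ (σ - 1) * prabhakarE α σ γ (-x ^ α)

theorem continuousOn_prabhakarKernel {α σ γ : ℝ} (hα : 0 < α) (hγ : 0 < γ) (hσ : 1 ≤ σ) :
    ContinuousOn (prabhakarKernel α σ γ) (Set.Ioi 0) := by
  refine ContinuousOn.mul (Real.continuous_rpow_const (by linarith)).continuousOn ?_
  exact ((continuous_prabhakarE hα hγ hσ).comp
    (Real.continuous_rpow_const hα.le).neg).continuousOn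

/-- The Laplace transform of the kernel. -/
noncomputable def prabhakarLaplace (α σ γ s : ℝ) : ℝ := s ^ (α * γ - σ) * (1 + s ^ α) ^ (-γ)

/-- For `s > 1` the Laplace transform can be computed term by term. -/
theorem laplace_prabhakarKernel_of_one_lt {α σ γ : ℝ} (hα : 0 < α) (hγ : 0 < γ) (hσ : 1 ≤ σ)
    {s : ℝ} (hs : 1 < s) :
    IntegrableOn (fun x => Real.exp (-(s * x)) * prabhakarKernel α σ γ x) (Set.Ioi 0) ∧
      ∫ x in Set.Ioi 0, Real.exp (-(s * x)) * prabhakarKernel α σ γ x =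
        prabhakarLaplace α σ γ s := by
  have hs0 : 0 < s := by linarith
  have hq0 : 0 < s ^ (-α) := by positivity
  have hq1 : s ^ (-α) < 1 := Real.rpow_lt_one_of_one_lt_of_neg hs (by linarith)
  have hpos : ∀ k : ℕ, 0 < α * k + σ := fun k => by positivity
  set F : ℕ → ℝ → ℝ := fun k x => binomCoeff γ k * (-1) ^ k / Real.Gamma (α * k + σ) *
    (x ^ (α * k + σ - 1) * Real.exp (-(s * x))) with hF
  have hFint : ∀ k, IntegrableOn (F k) (Set.Ioi 0) := fun k =>
    (integrableOn_rpow_sub_one_mul_exp_neg_mul (hpos k) hs0).const_mul _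
  have hI : ∀ k : ℕ, ∫ x in Set.Ioi 0, x ^ (α * k + σ - 1) * Real.exp (-(s * x)) =
      s ^ (-σ) * (s ^ (-α)) ^ k * Real.Gamma (α * k + σ) := by
    intro k
    rw [Real.integral_rpow_mul_exp_neg_mul_Ioi (hpos k) hs0, one_div, Real.inv_rpow hs0.le,
      ← Real.rpow_neg hs0.le, ← Real.rpow_natCast, ← Real.rpow_mul hs0.le, ← Real.rpow_add hs0]
    ring_nf
  have hFval : ∀ k, ∫ x in Set.Ioi 0, F k x =
      s ^ (-σ) * (binomCoeff γ k * (-s ^ (-α)) ^ k) := by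
    intro k
    have := (Real.Gamma_pos_of_pos (hpos k)).ne'
    simp only [hF]
    rw [integral_const_mul, hI, neg_pow (s ^ (-α))]
    field_simp
  have hFnorm : ∀ k, ∫ x in Set.Ioi 0, ‖F k x‖ =
      s ^ (-σ) * (binomCoeff γ k * (s ^ (-α)) ^ k) := by
    intro k
    have hG := Real.Gamma_pos_of_pos (hpos k)
    have : ∀ x ∈ Set.Ioi (0 : ℝ), ‖F k x‖ = binomCoeff γ k / Real.Gamma (α * k + σ) *
        (x ^ (α * k + σ - 1) * Real.exp (-(s * x))) := by
      intro x (hx : 0 < x)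
      simp only [hF, norm_mul, norm_div, norm_pow, norm_neg, norm_one, one_pow, mul_one]
      rw [Real.norm_of_nonneg (binomCoeff_nonneg hγ k), Real.norm_of_nonneg hG.le,
        Real.norm_of_nonneg (Real.exp_pos _).le, Real.norm_of_nonneg (by positivity)]
    rw [setIntegral_congr_fun measurableSet_Ioi this, integral_const_mul, hI]
    field_simp
  have hsum : Summable fun k => ∫ x in Set.Ioi 0, ‖F k x‖ := by
    simp only [hFnorm]
    exact (hasSum_binomCoeff_rpow γ (by rwa [abs_of_pos hq0])).summable.mul_left _
  have hEq : Set.EqOn (fun x => Real.exp (-(s * x)) * prabhakarKernel α σ γ x)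
      (fun x => ∑' k, F k x) (Set.Ioi 0) := by
    intro x (hx : 0 < x)
    simp only [prabhakarKernel, prabhakarE_eq_tsum hγ]
    rw [← mul_assoc, ← tsum_mul_left]
    refine tsum_congr fun k => ?_
    simp only [hF]
    rw [neg_pow, add_sub_assoc, Real.rpow_add hx, Real.rpow_mul hx.le, Real.rpow_natCast]
    ring
  have hm : AEStronglyMeasurable (fun x => ∑' k, F k x) (volume.restrict (Set.Ioi 0)) := by
    refine ContinuousOn.aestronglyMeasurable ?_ measurableSet_Ioi
    refine ContinuousOn.congr ?_ fun x hx => (hEq hx).symm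
    exact ContinuousOn.mul (by fun_prop) (continuousOn_prabhakarKernel hα hγ hσ)
  refine ⟨(integrable_tsum_of_summable_integral_norm hFint hsum hm).congr
    (ae_restrict_of_forall_mem measurableSet_Ioi fun x hx => (hEq hx).symm), ?_⟩
  rw [setIntegral_congr_fun measurableSet_Ioi hEq,
    ← integral_tsum_of_summable_integral_norm hFint hsum]
  simp only [hFval]
  rw [tsum_mul_left, (hasSum_binomCoeff_rpow γ (x := -s ^ (-α))
    (by rwa [abs_neg, abs_of_pos hq0])).tsum_eq, prabhakarLaplace]
  have e : 1 - -s ^ (-α) = s ^ (-α) * (1 + s ^ α) := by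
    rw [mul_add, ← Real.rpow_add hs0]
    simp
    ring
  rw [e, Real.mul_rpow hq0.le (by positivity), ← Real.rpow_mul hs0.le, ← mul_assoc,
    ← Real.rpow_add hs0]
  ring_nf

/-- The Laplace transform of the kernel at the integers `k + 2` is a product of two completely
monotone sequences. -/
theorem prabhakarKernel_nonneg {α σ γ : ℝ} (hα0 : 0 < α) (hα1 : α ≤ 1) (hγ : 0 < γ) (hσ : 1 ≤ σ)
    (hσγ : α * γ ≤ σ) {x : ℝ} (hx : 0 < x) : 0 ≤ prabhakarKernel α σ γ x := by
  have h2 := laplace_prabhakarKernel_of_one_lt hα0 hγ hσ one_lt_two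
  refine (mul_nonneg_iff_of_pos_left (Real.exp_pos (-(2 * x)))).1 ?_
  refine nonneg_of_isCM (w := fun x => Real.exp (-(2 * x)) * prabhakarKernel α σ γ x) h2.1
    (ContinuousOn.mul (by fun_prop) (continuousOn_prabhakarKernel hα0 hγ hσ)) ?_ hx
  have e : ∀ k : ℕ, ∫ x in Set.Ioi 0,
      Real.exp (-(2 * x)) * prabhakarKernel α σ γ x * Real.exp (-x) ^ k =
      ((k : ℝ) + 2) ^ (-(σ - α * γ)) * (1 + ((k : ℝ) + 2) ^ α) ^ (-γ) := by
    intro k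
    have := (laplace_prabhakarKernel_of_one_lt hα0 hγ hσ (s := k + 2)
      (by linarith [k.cast_nonneg (α := ℝ)])).2
    rw [prabhakarLaplace] at this
    rw [neg_sub, ← this]
    refine integral_congr_ae (Eventually.of_forall fun x => ?_)
    simp only
    rw [mul_right_comm, ← Real.exp_nat_mul, ← Real.exp_add]
    ring_nf
  simp only [e]
  exact (IsCM.rpow_neg (sub_nonneg.2 hσγ) two_pos).mul
    (IsCM.one_add_rpow_rpow_neg hα0 hα1 hγ two_pos)

/-! ### Continuation of Laplace transforms of nonnegative functions -/

/-- Two power series in a real variable with the same sums near `0` have the same coefficients. -/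
theorem coeff_eq_of_hasSum_eventually {c d : ℕ → ℂ} {g : ℝ → ℂ}
    (hc : ∀ᶠ t : ℝ in 𝓝 0, HasSum (fun n => (t : ℂ) ^ n * c n) (g t))
    (hd : ∀ᶠ t : ℝ in 𝓝 0, HasSum (fun n => (t : ℂ) ^ n * d n) (g t)) : c = d := by
  let p : (ℕ → ℂ) → FormalMultilinearSeries ℝ ℝ ℂ := fun e n =>
    ContinuousMultilinearMap.mkPiRing ℝ (Fin n) (e n)
  have hp : ∀ e n, (p e).coeff n = e n := fun e n => by
    simp [FormalMultilinearSeries.coeff, p]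
  have key : ∀ e : ℕ → ℂ, (∀ᶠ t : ℝ in 𝓝 0, HasSum (fun n => (t : ℂ) ^ n * e n) (g t)) →
      HasFPowerSeriesAt g (p e) 0 := by
    intro e he
    refine hasFPowerSeriesAt_iff.2 ?_
    filter_upwards [he] with t ht
    rw [zero_add]
    refine ht.congr_fun fun n => ?_
    rw [hp, Complex.real_smul, Complex.ofReal_pow]
  have h := (key c hc).eq_formalMultilinearSeries (key d hd)
  funext n
  rw [← hp c, h, hp d]

/-- The `n`-th Taylor coefficient at `2`, up to sign, of the Laplace transform of `f`. -/
noncomputable def laplaceCoeff (f : ℝ → ℝ) (n : ℕ) : ℝ :=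
  ∫ x in Set.Ioi 0, x ^ n / n.factorial * (Real.exp (-(2 * x)) * f x)

theorem pow_div_factorial_mul_le {f : ℝ → ℝ} (hf : ∀ x, 0 < x → 0 ≤ f x) (n : ℕ) {x : ℝ}
    (hx : 0 < x) : x ^ n / n.factorial * (Real.exp (-(2 * x)) * f x) ≤
      2 ^ n * (Real.exp (-(3 / 2 * x)) * f x) := by
  have h := Real.pow_div_factorial_le_exp (x / 2) (by positivity) n
  have e : x ^ n / n.factorial = 2 ^ n * ((x / 2) ^ n / n.factorial) := by
    rw [div_pow]
    field_simp
  have e2 : Real.exp (-(3 / 2 * x)) = Real.exp (x / 2) * Real.exp (-(2 * x)) := by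
    rw [← Real.exp_add]
    ring_nf
  have := hf x hx
  rw [e, e2, mul_assoc, mul_assoc (Real.exp (x / 2))]
  gcongr

theorem integrableOn_laplaceCoeff {f : ℝ → ℝ} (hf : ∀ x, 0 < x → 0 ≤ f x)
    (hL : ∀ s : ℝ, 1 < s → IntegrableOn (fun x => Real.exp (-(s * x)) * f x) (Set.Ioi 0)) (n : ℕ) :
    IntegrableOn (fun x => x ^ n / n.factorial * (Real.exp (-(2 * x)) * f x)) (Set.Ioi 0) := by
  refine Integrable.mono' ((hL (3 / 2) (by norm_num)).const_mul (2 ^ n)) ?_ ?_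
  · exact (Continuous.aestronglyMeasurable (by fun_prop)).mul (hL 2 one_lt_two).aestronglyMeasurable
  · refine ae_restrict_of_forall_mem measurableSet_Ioi fun x (hx : 0 < x) => ?_
    have := hf x hx
    rw [Real.norm_of_nonneg (by positivity)]
    exact pow_div_factorial_mul_le hf n hx

theorem laplaceCoeff_nonneg {f : ℝ → ℝ} (hf : ∀ x, 0 < x → 0 ≤ f x) (n : ℕ) :
    0 ≤ laplaceCoeff f n :=
  setIntegral_nonneg measurableSet_Ioi fun x (hx : 0 < x) => by
    have := hf x hx
    positivity

theorem laplaceCoeff_le {f : ℝ → ℝ} (hf : ∀ x, 0 < x → 0 ≤ f x)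
    (hL : ∀ s : ℝ, 1 < s → IntegrableOn (fun x => Real.exp (-(s * x)) * f x) (Set.Ioi 0)) (n : ℕ) :
    laplaceCoeff f n ≤ 2 ^ n * ∫ x in Set.Ioi 0, Real.exp (-(3 / 2 * x)) * f x := by
  rw [← integral_const_mul]
  exact setIntegral_mono_on (integrableOn_laplaceCoeff hf hL n)
    ((hL (3 / 2) (by norm_num)).const_mul _) measurableSet_Ioi
    fun x hx => pow_div_factorial_mul_le hf n hx

theorem hasSum_laplaceTaylor (f : ℝ → ℝ) (t x : ℝ) :
    HasSum (fun n : ℕ => t ^ n * (x ^ n / n.factorial * (Real.exp (-(2 * x)) * f x)))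
      (Real.exp (-((2 - t) * x)) * f x) := by
  have h := NormedSpace.expSeries_div_hasSum_exp (t * x)
  rw [← Real.exp_eq_exp_ℝ] at h
  have h' := h.mul_right (Real.exp (-(2 * x)) * f x)
  rw [← mul_assoc, ← Real.exp_add, show t * x + -(2 * x) = -((2 - t) * x) by ring] at h'
  refine h'.congr_fun fun n => ?_
  rw [mul_pow]
  ring

theorem hasSum_laplaceCoeff {f : ℝ → ℝ} (hf : ∀ x, 0 < x → 0 ≤ f x)
    (hL : ∀ s : ℝ, 1 < s → IntegrableOn (fun x => Real.exp (-(s * x)) * f x) (Set.Ioi 0))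
    {t : ℝ} (ht : |t| < 1 / 2) :
    HasSum (fun n => t ^ n * laplaceCoeff f n)
      (∫ x in Set.Ioi 0, Real.exp (-((2 - t) * x)) * f x) := by
  have hn : ∀ n : ℕ,
      ∫ x in Set.Ioi 0, ‖t ^ n * (x ^ n / n.factorial * (Real.exp (-(2 * x)) * f x))‖ =
      |t| ^ n * laplaceCoeff f n := by
    intro n
    rw [laplaceCoeff, ← integral_const_mul]
    refine setIntegral_congr_fun measurableSet_Ioi fun x (hx : 0 < x) => ?_
    have := hf x hx
    rw [norm_mul, norm_pow, Real.norm_eq_abs, Real.norm_of_nonneg (by positivity)]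
  have hs : Summable fun n => |t| ^ n * laplaceCoeff f n := by
    refine Summable.of_nonneg_of_le
      (fun n => mul_nonneg (by positivity) (laplaceCoeff_nonneg hf n))
      (fun n => mul_le_mul_of_nonneg_left (laplaceCoeff_le hf hL n) (by positivity)) ?_
    simp only [← mul_assoc, ← mul_pow]
    exact (summable_geometric_of_lt_one (by positivity) (by linarith)).mul_right _
  have := hasSum_integral_of_summable_integral_norm
    (fun n => (integrableOn_laplaceCoeff hf hL n).const_mul (t ^ n)) (by simpa only [hn] using hs)
  simp only [integral_const_mul, (hasSum_laplaceTaylor f t _).tsum_eq] at this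
  exact this

/-- A form of Landau's theorem: if the Laplace transform of a nonnegative function, convergent for
`s > 1`, extends holomorphically to the disc of radius `2` about `2`, then it converges on
`(0, 2)`, because the Taylor series at `2` can be integrated term by term. -/
theorem lintegral_laplace_eq_of_differentiableOn {f : ℝ → ℝ} {G : ℂ → ℂ}
    (hf : ∀ x, 0 < x → 0 ≤ f x)
    (hL : ∀ s : ℝ, 1 < s → IntegrableOn (fun x => Real.exp (-(s * x)) * f x) (Set.Ioi 0))
    (hG : DifferentiableOn ℂ G (Metric.ball 2 2))
    (hLG : ∀ s : ℝ, 1 < s → ((∫ x in Set.Ioi 0, Real.exp (-(s * x)) * f x : ℝ) : ℂ) = G s)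
    {s : ℝ} (hs0 : 0 < s) (hs2 : s ≤ 2) :
    ∫⁻ x in Set.Ioi 0, ENNReal.ofReal (Real.exp (-(s * x)) * f x) = ENNReal.ofReal (G s).re := by
  have hG' : DifferentiableOn ℂ (fun z => G (2 - z)) (Metric.ball 0 2) := by
    refine hG.comp (by fun_prop) fun z hz => ?_
    simpa [dist_eq_norm] using hz
  set q : ℕ → ℂ := fun n => (n.factorial : ℂ)⁻¹ * iteratedDeriv n (fun z => G (2 - z)) 0
  have hqs : ∀ t : ℝ, |t| < 2 → HasSum (fun n => (t : ℂ) ^ n * q n) (G (2 - t)) := by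
    intro t ht
    have := Complex.hasSum_taylorSeries_on_ball (r := 2) (z := (t : ℂ)) hG' (by simpa using ht)
    refine this.congr_fun fun n => ?_
    simp only [q, sub_zero, smul_eq_mul]
    ring
  -- The two expansions at `2` agree on `(-1/2, 1/2)`, hence have the same coefficients.
  have hcoeff : (fun n => (laplaceCoeff f n : ℂ)) = q := by
    refine coeff_eq_of_hasSum_eventually (g := fun t => G (2 - t)) ?_ ?_
    · have : ∀ᶠ t : ℝ in 𝓝 0, |t| < 1 / 2 := by
        filter_upwards [Metric.ball_mem_nhds (0 : ℝ) (half_pos one_pos)] with t ht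
        simpa using ht
      filter_upwards [this] with t ht
      have h := hasSum_laplaceCoeff hf hL ht
      have h2 := hLG (2 - t) (by linarith [(abs_lt.1 ht).2])
      push_cast at h2
      rw [← h2]
      exact_mod_cast h
    · filter_upwards [Metric.ball_mem_nhds (0 : ℝ) two_pos] with t ht
      exact hqs t (by simpa using ht)
  set t : ℝ := 2 - s with ht
  have ht0 : 0 ≤ t := by linarith
  have hsum : HasSum (fun n => t ^ n * laplaceCoeff f n) (G s).re := by
    have h := hqs t (by rw [abs_of_nonneg ht0]; linarith)
    rw [← hcoeff] at h
    have h' := Complex.hasSum_re h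
    have e : (2 : ℂ) - (t : ℂ) = s := by rw [ht]; push_cast; ring
    rw [e] at h'
    refine h'.congr_fun fun n => ?_
    rw [← Complex.ofReal_pow, ← Complex.ofReal_mul, Complex.ofReal_re]
  have hpt : ∀ x ∈ Set.Ioi (0 : ℝ), ENNReal.ofReal (Real.exp (-(s * x)) * f x) =
      ∑' n : ℕ, ENNReal.ofReal (t ^ n * (x ^ n / n.factorial * (Real.exp (-(2 * x)) * f x))) := by
    intro x (hx : 0 < x)
    have h := hasSum_laplaceTaylor f t x
    have := hf x hx
    rw [← ENNReal.ofReal_tsum_of_nonneg (fun n => by positivity) h.summable, h.tsum_eq, ht]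
    ring_nf
  rw [setLIntegral_congr_fun measurableSet_Ioi hpt, lintegral_tsum fun n =>
    ((integrableOn_laplaceCoeff hf hL n).const_mul (t ^ n)).aemeasurable.ennreal_ofReal]
  rw [← hsum.tsum_eq, ENNReal.ofReal_tsum_of_nonneg
    (fun n => mul_nonneg (by positivity) (laplaceCoeff_nonneg hf n)) hsum.summable]
  refine tsum_congr fun n => ?_
  rw [laplaceCoeff, ← integral_const_mul, ofReal_integral_eq_lintegral_ofReal
    ((integrableOn_laplaceCoeff hf hL n).const_mul (t ^ n))]
  refine ae_restrict_of_forall_mem measurableSet_Ioi fun x (hx : 0 < x) => ?_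
  have := hf x hx
  simp only [Pi.zero_apply]
  positivity

/-- As `α ≤ 1`, the principal power `z ^ α` maps the right half-plane into itself, so `1 + z ^ α`
stays off the branch cut. -/
theorem differentiableAt_prabhakarLaplace {α σ γ : ℝ} (hα0 : 0 < α) (hα1 : α ≤ 1) {z : ℂ}
    (hz : 0 < z.re) : DifferentiableAt ℂ
      (fun z : ℂ => z ^ ((α * γ - σ : ℝ) : ℂ) * (1 + z ^ (α : ℂ)) ^ (-(γ : ℂ))) z := by
  have hz' : z ∈ Complex.slitPlane := Or.inl hz
  have hre : 0 < (z ^ (α : ℂ)).re := by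
    have hz0 : z ≠ 0 := fun h => by simp [h] at hz
    have harg := abs_lt.1 (Complex.abs_arg_lt_pi_div_two_iff.2 (Or.inl hz))
    rw [Complex.cpow_ofReal_re]
    refine mul_pos (Real.rpow_pos_of_pos (norm_pos_iff.2 hz0) _) (Real.cos_pos_of_mem_Ioo ?_)
    constructor <;> nlinarith [Real.pi_pos]
  have h1 : (1 + z ^ (α : ℂ)) ∈ Complex.slitPlane := Or.inl (by simp; linarith)
  exact (differentiableAt_id.cpow_const hz').mul
    (((differentiableAt_const 1).add (differentiableAt_id.cpow_const hz')).cpow_const h1)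

/-- The formula for the Laplace transform of the kernel, extended from `s > 1` to all `s > 0`. -/
theorem lintegral_laplace_prabhakarKernel {α σ γ : ℝ} (hα0 : 0 < α) (hα1 : α ≤ 1) (hγ : 0 < γ)
    (hσ : 1 ≤ σ) (hσγ : α * γ ≤ σ) {s : ℝ} (hs : 0 < s) :
    ∫⁻ x in Set.Ioi 0, ENNReal.ofReal (Real.exp (-(s * x)) * prabhakarKernel α σ γ x) =
      ENNReal.ofReal (prabhakarLaplace α σ γ s) := by
  have hnn : ∀ x, 0 < x → 0 ≤ prabhakarKernel α σ γ x := fun x hx =>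
    prabhakarKernel_nonneg hα0 hα1 hγ hσ hσγ hx
  have hL := fun (s : ℝ) (hs : 1 < s) => laplace_prabhakarKernel_of_one_lt hα0 hγ hσ hs
  rcases lt_or_ge 2 s with h2 | h2
  · rw [← (hL s (by linarith)).2, ofReal_integral_eq_lintegral_ofReal (hL s (by linarith)).1]
    refine ae_restrict_of_forall_mem measurableSet_Ioi fun x (hx : 0 < x) => ?_
    exact mul_nonneg (Real.exp_pos _).le (hnn x hx)
  have hG : ∀ s : ℝ, 0 < s → ((prabhakarLaplace α σ γ s : ℝ) : ℂ) =
      (s : ℂ) ^ ((α * γ - σ : ℝ) : ℂ) * (1 + (s : ℂ) ^ (α : ℂ)) ^ (-(γ : ℂ)) := by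
    intro s hs
    rw [prabhakarLaplace, Complex.ofReal_mul, Complex.ofReal_cpow hs.le,
      Complex.ofReal_cpow (by positivity), Complex.ofReal_add, Complex.ofReal_cpow hs.le]
    push_cast
    rfl
  rw [lintegral_laplace_eq_of_differentiableOn hnn (fun s hs => (hL s hs).1)
    (G := fun z : ℂ => z ^ ((α * γ - σ : ℝ) : ℂ) * (1 + z ^ (α : ℂ)) ^ (-(γ : ℂ)))
    (fun z hz => ?_) (fun s hs => ?_) hs h2]
  · rw [← hG s hs, Complex.ofReal_re]
  · refine (differentiableAt_prabhakarLaplace hα0 hα1 ?_).differentiableWithinAt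
    have h := (Complex.abs_re_le_norm (z - 2)).trans_lt (by simpa [dist_eq_norm] using hz)
    have := (abs_lt.1 h).1
    simp at this
    linarith
  · rw [(hL s hs).2, hG s (by linarith)]

/-! ### The Lévy measure and its Laplace exponent -/

/-- The constant in front of the Lévy density. -/
noncomputable def prabhakarConst (α σ γ : ℝ) : ℝ :=
  α * Real.Gamma γ / Real.Gamma (γ + (1 - σ) / α)

theorem hypergeometric_parameter_pos {α σ γ : ℝ} (hα : 0 < α) (hσ2 : σ < 1 + α * γ) :
    0 < γ + (1 - σ) / α := by
  have : γ + (1 - σ) / α = (1 + α * γ - σ) / α := by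
    field_simp
    ring
  rw [this]
  exact div_pos (by linarith) hα

theorem prabhakarConst_pos {α σ γ : ℝ} (hα : 0 < α) (hγ : 0 < γ) (hσ2 : σ < 1 + α * γ) :
    0 < prabhakarConst α σ γ :=
  div_pos (mul_pos hα (Real.Gamma_pos_of_pos hγ))
    (Real.Gamma_pos_of_pos (hypergeometric_parameter_pos hα hσ2))

theorem prabhakarLevyDensity_one_eq {α σ γ x : ℝ} (hx : 0 < x) :
    prabhakarLevyDensity α σ γ 1 x = prabhakarConst α σ γ * (x⁻¹ * prabhakarKernel α σ γ x) := by
  rw [prabhakarLevyDensity, prabhakarConst, prabhakarKernel, one_mul,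
    show σ - 1 = (σ - 2) + 1 by ring, Real.rpow_add_one hx.ne']
  field_simp

theorem continuousOn_prabhakarLevyDensity {α σ γ : ℝ} (hα : 0 < α) (hγ : 0 < γ) (hσ : 1 ≤ σ) :
    ContinuousOn (prabhakarLevyDensity α σ γ 1) (Set.Ioi 0) := by
  refine ContinuousOn.congr (f := fun x =>
    prabhakarConst α σ γ * (x⁻¹ * prabhakarKernel α σ γ x)) ?_
    fun x hx => prabhakarLevyDensity_one_eq hx
  exact continuousOn_const.mul ((continuousOn_inv₀.mono fun x hx => ne_of_gt hx).mul
    (continuousOn_prabhakarKernel hα hγ hσ))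

theorem prabhakarLaplace_nonneg {α σ γ u : ℝ} (hu : 0 < u) : 0 ≤ prabhakarLaplace α σ γ u := by
  rw [prabhakarLaplace]
  positivity

theorem integrableOn_prabhakarLaplace {α σ γ : ℝ} (hγ : 0 < γ)
    (hσ2 : σ < 1 + α * γ) {s : ℝ} (hs : 0 ≤ s) :
    IntegrableOn (prabhakarLaplace α σ γ) (Set.Ioc 0 s) := by
  have hint : IntegrableOn (fun u : ℝ => u ^ (α * γ - σ)) (Set.Ioc 0 s) := by
    have := intervalIntegral.intervalIntegrable_rpow' (a := 0) (b := s) (r := α * γ - σ)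
      (by linarith)
    rwa [intervalIntegrable_iff_integrableOn_Ioc_of_le hs] at this
  refine Integrable.mono' hint ?_ ?_
  · have : Measurable (prabhakarLaplace α σ γ) := by
      unfold prabhakarLaplace
      fun_prop
    exact this.aestronglyMeasurable
  · refine ae_restrict_of_forall_mem measurableSet_Ioc fun u hu => ?_
    rw [Real.norm_of_nonneg (prabhakarLaplace_nonneg hu.1), prabhakarLaplace]
    have hu0 := hu.1
    have h1 : 1 ≤ 1 + u ^ α := by linarith [Real.rpow_nonneg hu0.le α]
    exact mul_le_of_le_one_right (by positivity)
      (Real.rpow_le_one_of_one_le_of_nonpos h1 (by linarith))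

theorem inv_mul_one_sub_exp_eq_lintegral {x s : ℝ} (hx : 0 < x) (hs : 0 ≤ s) :
    ENNReal.ofReal (x⁻¹ * (1 - Real.exp (-(s * x)))) =
      ∫⁻ u in Set.Ioc 0 s, ENNReal.ofReal (Real.exp (-(u * x))) := by
  have hcont : Continuous fun u : ℝ => Real.exp (-(u * x)) := by fun_prop
  rw [← ofReal_integral_eq_lintegral_ofReal
    ((hcont.intervalIntegrable 0 s).1) (Eventually.of_forall fun u => (Real.exp_pos _).le),
    ← intervalIntegral.integral_of_le hs]
  congr 1
  have hd : ∀ u ∈ Set.uIcc 0 s, HasDerivAt (fun u : ℝ => -x⁻¹ * Real.exp (-(u * x)))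
      (Real.exp (-(u * x))) u := by
    intro u _
    have h := ((hasDerivAt_mul_const (x := u) x).fun_neg.exp).const_mul (-x⁻¹)
    convert! h using 1
    field_simp
  rw [intervalIntegral.integral_eq_sub_of_hasDerivAt hd (hcont.intervalIntegrable 0 s)]
  simp
  ring

/-- The Laplace exponent: `1 - exp (-s x)` is `x` times the integral of `exp (-u x)` over
`0 < u ≤ s`, so Tonelli reduces it to the Laplace transform of the kernel. -/
theorem lintegral_one_sub_exp_prabhakarLevyMeasure {α σ γ : ℝ} (hα0 : 0 < α) (hα1 : α ≤ 1)
    (hγ : 0 < γ) (hσ1 : 1 ≤ σ) (hσγ : α * γ ≤ σ) (hσ2 : σ < 1 + α * γ) {s : ℝ} (hs : 0 ≤ s) :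
    ∫⁻ x, ENNReal.ofReal (1 - Real.exp (-(s * x))) ∂(prabhakarLevyMeasure α σ γ 1) =
      ENNReal.ofReal (prabhakarConst α σ γ * ∫ u in Set.Ioc 0 s, prabhakarLaplace α σ γ u) := by
  have hC := prabhakarConst_pos hα0 hγ hσ2
  have hKm : AEMeasurable (prabhakarKernel α σ γ) (volume.restrict (Set.Ioi 0)) :=
    (continuousOn_prabhakarKernel hα0 hγ hσ1).aemeasurable measurableSet_Ioi
  have hdm : AEMeasurable (fun x => ENNReal.ofReal (prabhakarLevyDensity α σ γ 1 x))
      (volume.restrict (Set.Ioi 0)) :=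
    ((continuousOn_prabhakarLevyDensity hα0 hγ hσ1).aemeasurable measurableSet_Ioi).ennreal_ofReal
  rw [prabhakarLevyMeasure, lintegral_withDensity_eq_lintegral_mul₀ hdm
    (Measurable.aemeasurable (by fun_prop))]
  have hpt : ∀ x ∈ Set.Ioi (0 : ℝ), ((fun x => ENNReal.ofReal (prabhakarLevyDensity α σ γ 1 x)) *
      fun x => ENNReal.ofReal (1 - Real.exp (-(s * x)))) x =
      ENNReal.ofReal (prabhakarConst α σ γ) * ∫⁻ u in Set.Ioc 0 s,
        ENNReal.ofReal (Real.exp (-(u * x)) * prabhakarKernel α σ γ x) := by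
    intro x (hx : 0 < x)
    have hK := prabhakarKernel_nonneg hα0 hα1 hγ hσ1 hσγ hx
    simp only [Pi.mul_apply, ENNReal.ofReal_mul (Real.exp_pos _).le]
    rw [lintegral_mul_const _ (by fun_prop), ← inv_mul_one_sub_exp_eq_lintegral hx hs,
      prabhakarLevyDensity_one_eq hx, ← ENNReal.ofReal_mul' hK, ← ENNReal.ofReal_mul hC.le,
      ← ENNReal.ofReal_mul (by positivity)]
    ring_nf
  have hswap : AEMeasurable (Function.uncurry fun x u : ℝ =>
      ENNReal.ofReal (Real.exp (-(u * x)) * prabhakarKernel α σ γ x))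
      ((volume.restrict (Set.Ioi 0)).prod (volume.restrict (Set.Ioc 0 s))) :=
    ((Measurable.aemeasurable (by fun_prop)).mul hKm.comp_fst).ennreal_ofReal
  have hconst : ∫⁻ x in Set.Ioi 0, ENNReal.ofReal (prabhakarConst α σ γ) *
      ∫⁻ u in Set.Ioc 0 s, ENNReal.ofReal (Real.exp (-(u * x)) * prabhakarKernel α σ γ x) =
      ENNReal.ofReal (prabhakarConst α σ γ) * ∫⁻ x in Set.Ioi 0,
        ∫⁻ u in Set.Ioc 0 s, ENNReal.ofReal (Real.exp (-(u * x)) * prabhakarKernel α σ γ x) :=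
    lintegral_const_mul'' _ hswap.lintegral_prod_right'
  rw [setLIntegral_congr_fun measurableSet_Ioi hpt, hconst, lintegral_lintegral_swap hswap,
    setLIntegral_congr_fun measurableSet_Ioc fun u hu =>
      lintegral_laplace_prabhakarKernel hα0 hα1 hγ hσ1 hσγ hu.1,
    ENNReal.ofReal_mul hC.le, ofReal_integral_eq_lintegral_ofReal
      (integrableOn_prabhakarLaplace hγ hσ2 hs)]
  exact ae_restrict_of_forall_mem measurableSet_Ioc fun u hu => prabhakarLaplace_nonneg hu.1

theorem isSubordinatorLevyMeasure_prabhakarLevyMeasure {α σ γ : ℝ} (hα0 : 0 < α) (hα1 : α ≤ 1)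
    (hγ : 0 < γ) (hσ1 : 1 ≤ σ) (hσγ : α * γ ≤ σ) (hσ2 : σ < 1 + α * γ) :
    IsSubordinatorLevyMeasure (prabhakarLevyMeasure α σ γ 1) := by
  have h0 : prabhakarLevyMeasure α σ γ 1 (Set.Iic 0) = 0 := by
    have hr : (volume.restrict (Set.Ioi (0 : ℝ))) (Set.Iic 0) = 0 := by
      rw [Measure.restrict_apply measurableSet_Iic, Set.Iic_inter_Ioi, Set.Ioc_self, measure_empty]
    exact withDensity_absolutelyContinuous _ _ hr
  refine ⟨h0, ?_⟩
  have hle : ∀ᵐ x ∂(prabhakarLevyMeasure α σ γ 1), ENNReal.ofReal (min 1 x) ≤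
      2 * ENNReal.ofReal (1 - Real.exp (-(1 * x))) := by
    have hpos : ∀ᵐ x ∂(prabhakarLevyMeasure α σ γ 1), 0 < x := by
      rw [ae_iff]
      simp only [not_lt]
      exact h0
    filter_upwards [hpos] with x hx
    rw [← ENNReal.ofReal_ofNat, ← ENNReal.ofReal_mul (by norm_num)]
    refine ENNReal.ofReal_le_ofReal ?_
    -- Both sides are compared through `exp (-x) ≤ 1 / (1 + x)`.
    have h1 : Real.exp (-(1 * x)) ≤ (1 + x)⁻¹ := by
      rw [one_mul, Real.exp_neg]
      gcongr
      linarith [Real.add_one_le_exp x]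
    have h2 : min 1 x ≤ 2 * (1 - (1 + x)⁻¹) := by
      have e : 2 * (1 - (1 + x)⁻¹) = 2 * x / (1 + x) := by
        field_simp
        ring
      rw [e, le_div_iff₀ (by linarith)]
      rcases le_total 1 x with h | h
      · rw [min_eq_left h]; linarith
      · rw [min_eq_right h]; nlinarith
    linarith
  calc ∫⁻ x, ENNReal.ofReal (min 1 x) ∂(prabhakarLevyMeasure α σ γ 1)
      ≤ ∫⁻ x, 2 * ENNReal.ofReal (1 - Real.exp (-(1 * x))) ∂(prabhakarLevyMeasure α σ γ 1) :=
        lintegral_mono_ae hle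
    _ < ∞ := by
        rw [lintegral_const_mul _ (by fun_prop), lintegral_one_sub_exp_prabhakarLevyMeasure
          hα0 hα1 hγ hσ1 hσγ hσ2 zero_le_one]
        exact ENNReal.mul_lt_top (by simp) ENNReal.ofReal_lt_top

/-! ### Euler's integral for the hypergeometric function -/

/-- Euler's integral for `₂F₁(γ, b; b + 1; z)`, which converges on the whole cut plane. -/
noncomputable def eulerIntegral (γ b : ℝ) (z : ℂ) : ℂ :=
  b * ∫ t in Set.Ioo (0 : ℝ) 1, ((t ^ (b - 1) : ℝ) : ℂ) * (1 - t * z) ^ (-(γ : ℂ))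

theorem isOpen_cutPlane : IsOpen cutPlane :=
  Complex.isOpen_slitPlane.preimage (by fun_prop)

theorem one_sub_mul_mem_slitPlane {z : ℂ} (hz : z ∈ cutPlane) {t : ℝ} (h0 : 0 ≤ t) (h1 : t ≤ 1) :
    1 - t * z ∈ Complex.slitPlane := by
  have h := Complex.starConvex_one_slitPlane hz (sub_nonneg.2 h1) h0 (by ring)
  convert h using 1
  simp only [Complex.real_smul]
  push_cast
  ring

theorem integrableOn_rpow_sub_one_Ioo {b : ℝ} (hb : 0 < b) :
    IntegrableOn (fun t : ℝ => t ^ (b - 1)) (Set.Ioo 0 1) := by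
  rw [intervalIntegral.integrableOn_Ioo_rpow_iff one_pos]
  linarith

theorem analyticOnNhd_eulerIntegral (γ : ℝ) {b : ℝ} (hb : 0 < b) :
    AnalyticOnNhd ℂ (eulerIntegral γ b) cutPlane := by
  refine DifferentiableOn.analyticOnNhd (fun z₀ hz₀ => ?_) isOpen_cutPlane
  refine DifferentiableAt.differentiableWithinAt (DifferentiableAt.const_mul ?_ _)
  obtain ⟨ε, hε, hball⟩ := Metric.nhds_basis_closedBall.mem_iff.1 (isOpen_cutPlane.mem_nhds hz₀)
  have hcont : ∀ a : ℂ, ContinuousOn (fun p : ℂ × ℝ => (1 - p.2 * p.1) ^ a)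
      (Metric.closedBall z₀ ε ×ˢ Set.Icc (0 : ℝ) 1) := fun a =>
    ContinuousOn.cpow_const (by fun_prop) fun p hp =>
      one_sub_mul_mem_slitPlane (hball hp.1) hp.2.1 hp.2.2
  obtain ⟨M, hM⟩ := ((isCompact_closedBall z₀ ε).prod isCompact_Icc).exists_bound_of_continuousOn
    (hcont (-(γ : ℂ) - 1))
  have hsec : ∀ (a z : ℂ), z ∈ Metric.closedBall z₀ ε →
      AEStronglyMeasurable (fun t : ℝ => (1 - t * z) ^ a) (volume.restrict (Set.Ioo 0 1)) := by
    intro a z hz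
    refine ContinuousOn.aestronglyMeasurable ?_ measurableSet_Ioo
    exact (hcont a).comp (f := fun t : ℝ => (z, t)) (by fun_prop)
      fun t ht => ⟨hz, Set.Ioo_subset_Icc_self ht⟩
  have hrm : AEStronglyMeasurable (fun t : ℝ => ((t ^ (b - 1) : ℝ) : ℂ))
      (volume.restrict (Set.Ioo 0 1)) :=
    (integrableOn_rpow_sub_one_Ioo hb).ofReal.aestronglyMeasurable
  have hz₀' : z₀ ∈ Metric.closedBall z₀ ε := Metric.mem_closedBall_self hε.le
  refine (hasDerivAt_integral_of_dominated_loc_of_deriv_le (μ := volume.restrict (Set.Ioo 0 1))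
    (F := fun z t => ((t ^ (b - 1) : ℝ) : ℂ) * (1 - t * z) ^ (-(γ : ℂ)))
    (F' := fun z t => ((t ^ (b - 1) : ℝ) : ℂ) * (-(γ : ℂ) * (1 - t * z) ^ (-(γ : ℂ) - 1) * (-t)))
    (bound := fun t => t ^ (b - 1) * (|γ| * M)) (Metric.ball_mem_nhds z₀ hε) ?_ ?_ ?_ ?_ ?_
    ?_).2.differentiableAt
  · filter_upwards [Metric.closedBall_mem_nhds z₀ hε] with z hz using hrm.mul (hsec _ z hz)
  · obtain ⟨M', hM'⟩ := ((isCompact_closedBall z₀ ε).prod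
      isCompact_Icc).exists_bound_of_continuousOn (hcont (-(γ : ℂ)))
    refine Integrable.mul_bdd (c := M') (integrableOn_rpow_sub_one_Ioo hb).ofReal
      (hsec _ z₀ hz₀') ?_
    exact ae_restrict_of_forall_mem measurableSet_Ioo fun t ht =>
      hM' (z₀, t) ⟨hz₀', Set.Ioo_subset_Icc_self ht⟩
  · exact hrm.mul (((hsec _ z₀ hz₀').const_mul _).mul
      (Continuous.aestronglyMeasurable (by fun_prop)))
  · refine ae_restrict_of_forall_mem measurableSet_Ioo fun t ht z hz => ?_
    have h := hM (z, t) ⟨Metric.ball_subset_closedBall hz, Set.Ioo_subset_Icc_self ht⟩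
    have ht0 : 0 < t := ht.1
    have hM0 : 0 ≤ M := (norm_nonneg _).trans h
    simp only [norm_mul, norm_neg, Complex.norm_real, Real.norm_eq_abs] at h ⊢
    rw [abs_of_pos ht0, abs_of_nonneg (Real.rpow_nonneg ht0.le _)]
    refine mul_le_mul_of_nonneg_left ?_ (by positivity)
    calc |γ| * ‖(1 - t * z) ^ (-(γ : ℂ) - 1)‖ * t ≤ |γ| * M * 1 := by
          gcongr
          exact ht.2.le
      _ = |γ| * M := mul_one _
  · exact (integrableOn_rpow_sub_one_Ioo hb).mul_const _
  · refine ae_restrict_of_forall_mem measurableSet_Ioo fun t ht z hz => ?_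
    have hs := one_sub_mul_mem_slitPlane (hball (Metric.ball_subset_closedBall hz)) ht.1.le ht.2.le
    have hd : HasDerivAt (fun z : ℂ => 1 - t * z) (-t) z := by
      simpa using ((hasDerivAt_id z).const_mul (t : ℂ)).const_sub 1
    exact (hd.cpow_const hs).const_mul _

theorem ascPochhammer_eval_mul_add (b : ℂ) (n : ℕ) :
    (ascPochhammer ℂ n).eval b * (b + n) = b * (ascPochhammer ℂ n).eval (b + 1) := by
  induction n with
  | zero => simp
  | succ n ih =>
    rw [ascPochhammer_succ_eval, ascPochhammer_succ_eval, ← mul_assoc b, ← ih]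
    push_cast
    ring

theorem eulerIntegral_eq_ordinaryHypergeometric {γ b : ℝ} (hγ : 0 < γ) (hb : 0 < b) {w : ℂ}
    (hw : ‖w‖ < 1) : eulerIntegral γ b w = ₂F₁ (γ : ℂ) (b : ℂ) ((b + 1 : ℝ) : ℂ) w := by
  have hbn : ∀ n : ℕ, 0 < b + n := fun n => by positivity
  set F : ℕ → ℝ → ℂ := fun n t =>
    (binomCoeff γ n * w ^ n : ℂ) * ((t ^ (b + n - 1) : ℝ) : ℂ) with hF
  have hFint : ∀ n, IntegrableOn (F n) (Set.Ioo 0 1) := fun n =>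
    (integrableOn_rpow_sub_one_Ioo (hbn n)).ofReal.const_mul _
  have hI : ∀ n : ℕ, ∫ t in Set.Ioo (0 : ℝ) 1, t ^ (b + n - 1) = 1 / (b + n) := by
    intro n
    rw [← integral_Ioc_eq_integral_Ioo, ← intervalIntegral.integral_of_le zero_le_one,
      integral_rpow (Or.inl (by linarith [hbn n]))]
    simp [(hbn n).ne']
  have hnorm : ∀ n, ∫ t in Set.Ioo (0 : ℝ) 1, ‖F n t‖ =
      binomCoeff γ n * ‖w‖ ^ n * (1 / (b + n)) := by
    intro n
    rw [← hI, ← integral_const_mul]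
    refine setIntegral_congr_fun measurableSet_Ioo fun t ht => ?_
    have := ht.1
    simp only [hF, norm_mul, norm_pow, Complex.norm_real]
    rw [Real.norm_of_nonneg (binomCoeff_nonneg hγ n), Real.norm_of_nonneg (by positivity)]
  have hsum : Summable fun n => ∫ t in Set.Ioo (0 : ℝ) 1, ‖F n t‖ := by
    simp only [hnorm]
    refine Summable.of_nonneg_of_le (fun n => ?_) (fun n => ?_)
      ((hasSum_binomCoeff_rpow γ (x := ‖w‖) (by simpa using hw)).summable.mul_right (1 / b))
    · have := binomCoeff_nonneg hγ n
      have := hbn n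
      positivity
    · have := binomCoeff_nonneg hγ n
      gcongr
      linarith [n.cast_nonneg (α := ℝ)]
  have hpt : ∀ t ∈ Set.Ioo (0 : ℝ) 1, ((t ^ (b - 1) : ℝ) : ℂ) * (1 - t * w) ^ (-(γ : ℂ)) =
      ∑' n, F n t := by
    intro t ht
    have htw : ‖(t : ℂ) * w‖ < 1 := by
      rw [norm_mul, Complex.norm_real, Real.norm_of_nonneg ht.1.le]
      nlinarith [norm_nonneg w, ht.1, ht.2]
    rw [← (hasSum_binomCoeff_cpow γ htw).tsum_eq, ← tsum_mul_left]
    refine tsum_congr fun n => ?_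
    simp only [hF]
    rw [show b + n - 1 = (b - 1) + n by ring, Real.rpow_add ht.1, Real.rpow_natCast]
    push_cast
    ring
  rw [eulerIntegral, setIntegral_congr_fun measurableSet_Ioo hpt,
    ← integral_tsum_of_summable_integral_norm hFint hsum, ← tsum_mul_left,
    ordinaryHypergeometric_eq_tsum]
  refine tsum_congr fun n => ?_
  have h1 : (ascPochhammer ℂ n).eval ((b + 1 : ℝ) : ℂ) ≠ 0 := by
    rw [← ofReal_ascPochhammer_eval]
    exact_mod_cast (ascPochhammer_pos n (b + 1) (by linarith)).ne'
  have h2 : (b + n : ℂ) ≠ 0 := by exact_mod_cast (hbn n).ne'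
  have h3 := ascPochhammer_eval_mul_add b n
  simp only [hF]
  rw [integral_const_mul, integral_complex_ofReal, hI, binomCoeff, smul_eq_mul, Complex.ofReal_div,
    ofReal_ascPochhammer_eval]
  push_cast at h1 ⊢
  have h4 : (n.factorial : ℂ) ≠ 0 := by exact_mod_cast n.factorial_ne_zero
  field_simp
  linear_combination (-(w ^ n * (ascPochhammer ℂ n).eval (γ : ℂ))) * h3

theorem gaussHypergeometric_eq_eulerIntegral {γ b : ℝ} (hγ : 0 < γ) (hb : 0 < b) {z : ℂ}
    (hz : z ∈ cutPlane) :
    gaussHypergeometric (γ : ℂ) (b : ℂ) ((b + 1 : ℝ) : ℂ) z = eulerIntegral γ b z :=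
  gaussHypergeometric_eq (analyticOnNhd_eulerIntegral γ hb)
    (fun _ hw => eulerIntegral_eq_ordinaryHypergeometric hγ hb hw) hz

theorem eulerIntegral_neg_ofReal (γ b : ℝ) {y : ℝ} (hy : 0 ≤ y) :
    eulerIntegral γ b ((-y : ℝ) : ℂ) =
      ((b * ∫ t in Set.Ioo (0 : ℝ) 1, t ^ (b - 1) * (1 + t * y) ^ (-γ) : ℝ) : ℂ) := by
  rw [eulerIntegral, Complex.ofReal_mul, ← integral_complex_ofReal]
  congr 1
  refine setIntegral_congr_fun measurableSet_Ioo fun t ht => ?_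
  have : 0 ≤ 1 + t * y := by have := ht.1; positivity
  rw [Complex.ofReal_mul, Complex.ofReal_cpow this]
  push_cast
  ring_nf

/-- The substitution `u = s t ^ (1 / α)` turns the Laplace exponent into Euler's integral. -/
theorem integral_prabhakarLaplace_eq {α σ γ : ℝ} (hα : 0 < α) {s : ℝ} (hs : 0 < s) :
    ∫ u in Set.Ioc 0 s, prabhakarLaplace α σ γ u = s ^ (α * γ - σ + 1) / α *
      ∫ t in Set.Ioo (0 : ℝ) 1, t ^ (γ + (1 - σ) / α - 1) * (1 + t * s ^ α) ^ (-γ) := by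
  have himg : (fun t : ℝ => s * t ^ α⁻¹) '' Set.Ioo 0 1 = Set.Ioo 0 s := by
    ext u
    constructor
    · rintro ⟨t, ht, rfl⟩
      have := ht.1
      refine ⟨by positivity, ?_⟩
      have := Real.rpow_lt_one ht.1.le ht.2 (inv_pos.2 hα)
      nlinarith
    · intro hu
      have h0 : 0 < u / s := div_pos hu.1 hs
      refine ⟨(u / s) ^ α, ⟨by positivity,
        Real.rpow_lt_one h0.le ((div_lt_one hs).2 hu.2) hα⟩, ?_⟩
      simp only
      rw [← Real.rpow_mul h0.le, mul_inv_cancel₀ hα.ne', Real.rpow_one]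
      field_simp
  have hderiv : ∀ t ∈ Set.Ioo (0 : ℝ) 1, HasDerivWithinAt (fun t : ℝ => s * t ^ α⁻¹)
      (s * (α⁻¹ * t ^ (α⁻¹ - 1))) (Set.Ioo 0 1) t := fun t ht =>
    ((Real.hasDerivAt_rpow_const (Or.inl ht.1.ne')).const_mul s).hasDerivWithinAt
  have hinj : Set.InjOn (fun t : ℝ => s * t ^ α⁻¹) (Set.Ioo 0 1) := by
    intro t ht t' ht' h
    have h' := mul_left_cancel₀ hs.ne' h
    exact (Real.rpow_left_inj ht.1.le ht'.1.le (inv_pos.2 hα).ne').1 h'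
  rw [integral_Ioc_eq_integral_Ioo, ← himg,
    integral_image_eq_integral_abs_deriv_smul measurableSet_Ioo hderiv hinj, ← integral_const_mul]
  refine setIntegral_congr_fun measurableSet_Ioo fun t ht => ?_
  have ht0 : 0 < t := ht.1
  simp only [prabhakarLaplace, smul_eq_mul]
  have hp : 0 < t ^ α⁻¹ := by positivity
  rw [abs_of_pos (by positivity), Real.mul_rpow hs.le hp.le, Real.mul_rpow hs.le hp.le,
    ← Real.rpow_mul ht0.le, ← Real.rpow_mul ht0.le, inv_mul_cancel₀ hα.ne', Real.rpow_one,
    Real.rpow_add_one hs.ne', mul_comm (s ^ α)]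
  have e : t ^ (γ + (1 - σ) / α - 1) = t ^ (α⁻¹ - 1) * t ^ (α⁻¹ * (α * γ - σ)) := by
    rw [← Real.rpow_add ht0]
    congr 1
    field_simp
    ring
  rw [e]
  ring

theorem prabhakarConst_mul_integral_eq {α σ γ : ℝ} (hα : 0 < α) (hγ : 0 < γ)
    (hσ2 : σ < 1 + α * γ) {s : ℝ} (hs : 0 < s) :
    ((prabhakarConst α σ γ * ∫ u in Set.Ioc 0 s, prabhakarLaplace α σ γ u : ℝ) : ℂ) =
      ((s ^ (α * γ - σ + 1) * Real.Gamma γ / Real.Gamma (γ + 1 + (1 - σ) / α) : ℝ) : ℂ) *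
        gaussHypergeometric (γ : ℂ) ((γ + (1 - σ) / α : ℝ) : ℂ)
          ((1 + γ + (1 - σ) / α : ℝ) : ℂ) ((-(s ^ α) : ℝ) : ℂ) := by
  have hb := hypergeometric_parameter_pos hα hσ2
  rw [show 1 + γ + (1 - σ) / α = γ + (1 - σ) / α + 1 by ring,
    show γ + 1 + (1 - σ) / α = γ + (1 - σ) / α + 1 by ring, integral_prabhakarLaplace_eq hα hs,
    prabhakarConst]
  set b := γ + (1 - σ) / α
  have hsα : 0 < s ^ α := by positivity
  have hz : ((-(s ^ α) : ℝ) : ℂ) ∈ cutPlane := by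
    refine Or.inl ?_
    simp only [Complex.sub_re, Complex.one_re, Complex.ofReal_re]
    linarith
  rw [gaussHypergeometric_eq_eulerIntegral hγ hb hz, eulerIntegral_neg_ofReal _ _ hsα.le,
    ← Complex.ofReal_mul, Real.Gamma_add_one hb.ne']
  congr 1
  have := (Real.Gamma_pos_of_pos hb).ne'
  generalize ∫ t in Set.Ioo (0 : ℝ) 1, t ^ (b - 1) * (1 + t * s ^ α) ^ (-γ) = J
  field_simp

/-! ### From the characteristic function to the Laplace transform -/

/-- The Laplace exponent, up to sign, of the measure `ν`, as a function on the right half-plane. -/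
noncomputable def laplaceExponent (ν : Measure ℝ) (z : ℂ) : ℂ :=
  ∫ x : ℝ, (Complex.exp (-(z * x)) - 1) ∂ν

theorem norm_cexp_neg_mul_le_one {z : ℂ} (hz : 0 ≤ z.re) {x : ℝ} (hx : 0 ≤ x) :
    ‖Complex.exp (-(z * x))‖ ≤ 1 := by
  rw [Complex.norm_exp]
  refine Real.exp_le_one_iff.2 ?_
  simp only [Complex.neg_re, Complex.re_mul_ofReal]
  have := mul_nonneg hz hx
  linarith

theorem norm_cexp_neg_mul_sub_one_le {z : ℂ} (hz : 0 ≤ z.re) {x : ℝ} (hx : 0 ≤ x) :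
    ‖Complex.exp (-(z * x)) - 1‖ ≤ 2 * (1 + ‖z‖) * min 1 x := by
  have h2 : ‖Complex.exp (-(z * x)) - 1‖ ≤ 2 := by
    refine (norm_sub_le _ _).trans ?_
    rw [norm_one]
    linarith [norm_cexp_neg_mul_le_one hz hx]
  have hn := norm_nonneg z
  rcases le_total 1 x with h | h
  · rw [min_eq_left h]
    linarith
  · rw [min_eq_right h]
    have e : ‖-(z * (x : ℂ))‖ = ‖z‖ * x := by
      rw [norm_neg, norm_mul, Complex.norm_real, Real.norm_of_nonneg hx]
    rcases le_total (‖z‖ * x) 1 with h1 | h1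
    · have := Complex.norm_exp_sub_one_le (x := -(z * (x : ℂ))) (by rw [e]; exact h1)
      rw [e] at this
      nlinarith
    · nlinarith

section LaplaceExponent

variable {ν : Measure ℝ}

theorem aestronglyMeasurable_cexp_sub_one (z : ℂ) :
    AEStronglyMeasurable (fun x : ℝ => Complex.exp (-(z * x)) - 1) ν :=
  Continuous.aestronglyMeasurable (by fun_prop)

theorem integrable_cexp_sub_one (hν0 : ∀ᵐ x ∂ν, 0 ≤ x) (hν : Integrable (fun x : ℝ => min 1 x) ν)
    {z : ℂ} (hz : 0 ≤ z.re) : Integrable (fun x : ℝ => Complex.exp (-(z * x)) - 1) ν := by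
  refine Integrable.mono' (hν.const_mul (2 * (1 + ‖z‖))) (aestronglyMeasurable_cexp_sub_one z) ?_
  filter_upwards [hν0] with x hx using norm_cexp_neg_mul_sub_one_le hz hx

theorem re_laplaceExponent_nonpos (hν0 : ∀ᵐ x ∂ν, 0 ≤ x)
    (hν : Integrable (fun x : ℝ => min 1 x) ν) {z : ℂ} (hz : 0 ≤ z.re) :
    (laplaceExponent ν z).re ≤ 0 := by
  have h := (Complex.reCLM.integral_comp_comm (integrable_cexp_sub_one hν0 hν hz)).symm
  simp only [Complex.reCLM_apply] at h
  rw [laplaceExponent, h]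
  refine integral_nonpos_of_ae ?_
  filter_upwards [hν0] with x hx
  have := (Complex.re_le_norm _).trans (norm_cexp_neg_mul_le_one hz hx)
  simpa using this

theorem differentiableAt_laplaceExponent (hν0 : ∀ᵐ x ∂ν, 0 ≤ x)
    (hν : Integrable (fun x : ℝ => min 1 x) ν) {z₀ : ℂ} (hz₀ : 0 < z₀.re) :
    DifferentiableAt ℂ (laplaceExponent ν) z₀ := by
  set ε := z₀.re / 2 with hεdef
  have hε : 0 < ε := by positivity
  have hball : ∀ z ∈ Metric.ball z₀ ε, ε ≤ z.re := by
    intro z hz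
    have h := (Complex.abs_re_le_norm (z - z₀)).trans_lt (by simpa [dist_eq_norm] using hz)
    have := (abs_lt.1 h).1
    rw [Complex.sub_re] at this
    linarith
  refine (hasDerivAt_integral_of_dominated_loc_of_deriv_le (μ := ν)
    (F := fun z (x : ℝ) => Complex.exp (-(z * x)) - 1)
    (F' := fun z (x : ℝ) => Complex.exp (-(z * x)) * (-x))
    (bound := fun x => (1 + ε⁻¹) * min 1 x) (Metric.ball_mem_nhds z₀ hε)
    (Eventually.of_forall fun z => aestronglyMeasurable_cexp_sub_one z)
    (integrable_cexp_sub_one hν0 hν hz₀.le) (Continuous.aestronglyMeasurable (by fun_prop)) ?_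
    (hν.const_mul _) ?_).2.differentiableAt
  · filter_upwards [hν0] with x hx z hz
    have hzε := hball z hz
    have hi := inv_pos.2 hε
    rw [norm_mul, norm_neg, Complex.norm_real, Real.norm_of_nonneg hx]
    rcases le_total 1 x with h | h
    · rw [min_eq_left h, Complex.norm_exp]
      simp only [Complex.neg_re, Complex.re_mul_ofReal]
      have h1 : Real.exp (-(z.re * x)) ≤ Real.exp (-(ε * x)) := by gcongr
      have h2 : Real.exp (-(ε * x)) ≤ (ε * x)⁻¹ := by
        rw [Real.exp_neg]
        have : 0 < ε * x := by positivity
        gcongr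
        linarith [Real.add_one_le_exp (ε * x)]
      calc Real.exp (-(z.re * x)) * x ≤ (ε * x)⁻¹ * x := by
            gcongr
            exact h1.trans h2
        _ = ε⁻¹ := by field_simp
        _ ≤ _ := by linarith
    · rw [min_eq_right h]
      have := norm_cexp_neg_mul_le_one (hε.le.trans hzε) hx
      nlinarith
  · refine Eventually.of_forall fun x z _ => ?_
    exact ((hasDerivAt_mul_const (x := z) (x : ℂ)).fun_neg.cexp).sub_const 1

theorem diffContOnCl_laplaceExponent (hν0 : ∀ᵐ x ∂ν, 0 ≤ x)
    (hν : Integrable (fun x : ℝ => min 1 x) ν) :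
    DiffContOnCl ℂ (laplaceExponent ν) {z | 0 < z.re} := by
  refine ⟨fun z hz => (differentiableAt_laplaceExponent hν0 hν hz).differentiableWithinAt, ?_⟩
  rw [Complex.closure_setOfPred_lt_re]
  intro z₀ hz₀
  refine continuousWithinAt_of_dominated (bound := fun x => 2 * (1 + (‖z₀‖ + 1)) * min 1 x)
    (Eventually.of_forall fun z => aestronglyMeasurable_cexp_sub_one z) ?_ (hν.const_mul _)
    (Eventually.of_forall fun x => Continuous.continuousWithinAt (by fun_prop))
  have hnear : ∀ᶠ z in 𝓝[{z : ℂ | 0 ≤ z.re}] z₀, ‖z‖ < ‖z₀‖ + 1 :=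
    (continuous_norm.tendsto z₀).mono_left nhdsWithin_le_nhds |>.eventually
      (gt_mem_nhds (by linarith))
  filter_upwards [hnear, self_mem_nhdsWithin] with z hz hz0
  filter_upwards [hν0] with x hx
  refine (norm_cexp_neg_mul_sub_one_le hz0 hx).trans ?_
  have : 0 ≤ min 1 x := le_min zero_le_one hx
  gcongr

end LaplaceExponent

/-- For a law on `[0, ∞)`, the Lévy–Khintchine formula extends from the imaginary axis to the
right half-plane: the difference of the two sides is bounded and holomorphic there and vanishes on
the boundary, so it is zero by the Phragmén–Lindelöf principle. -/
theorem integral_cexp_neg_mul_eq_exp_laplaceExponent {μ ν : Measure ℝ} [IsProbabilityMeasure μ]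
    (hμ0 : ∀ᵐ x ∂μ, 0 ≤ x) (hν0 : ∀ᵐ x ∂ν, 0 ≤ x) (hν : Integrable (fun x : ℝ => min 1 x) ν)
    (hchar : ∀ u : ℝ, charFun μ u =
      Complex.exp (∫ x : ℝ, (Complex.exp (Complex.I * u * x) - 1) ∂ν)) {z : ℂ} (hz : 0 ≤ z.re) :
    ∫ x : ℝ, Complex.exp (-(z * x)) ∂μ = Complex.exp (laplaceExponent ν z) := by
  have hμ : Integrable (fun x : ℝ => min 1 x) μ := by
    refine Integrable.mono' (integrable_const 1) (Continuous.aestronglyMeasurable (by fun_prop)) ?_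
    filter_upwards [hμ0] with x hx
    rw [Real.norm_of_nonneg (le_min zero_le_one hx)]
    exact min_le_left _ _
  have hH : ∀ z : ℂ, 0 ≤ z.re → 1 + laplaceExponent μ z = ∫ x : ℝ, Complex.exp (-(z * x)) ∂μ := by
    intro z hz
    have h := integral_add (integrable_cexp_sub_one hμ0 hμ hz) (integrable_const (1 : ℂ))
    simp only [sub_add_cancel, integral_const, probReal_univ, one_smul] at h
    rw [h, laplaceExponent, add_comm]
  set f : ℂ → ℂ := fun z => 1 + laplaceExponent μ z - Complex.exp (laplaceExponent ν z) with hf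
  have hbound : ∀ z : ℂ, 0 ≤ z.re → ‖f z‖ ≤ 2 := by
    intro z hz
    have h1 : ‖1 + laplaceExponent μ z‖ ≤ 1 := by
      rw [hH z hz]
      have := norm_integral_le_of_norm_le_const (μ := μ) (C := 1)
        (f := fun x : ℝ => Complex.exp (-(z * x)))
        (by filter_upwards [hμ0] with x hx using norm_cexp_neg_mul_le_one hz hx)
      simpa using this
    have h2 : ‖Complex.exp (laplaceExponent ν z)‖ ≤ 1 := by
      rw [Complex.norm_exp]
      exact Real.exp_le_one_iff.2 (re_laplaceExponent_nonpos hν0 hν hz)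
    exact (norm_sub_le _ _).trans (by linarith)
  have hd : DiffContOnCl ℂ f {z | 0 < z.re} := by
    have h1 := diffContOnCl_laplaceExponent hμ0 hμ
    have h2 := diffContOnCl_laplaceExponent hν0 hν
    refine ⟨?_, ?_⟩
    · exact (h1.1.const_add 1).sub h2.1.cexp
    · exact (continuousOn_const.add h1.2).sub h2.2.cexp
  -- On the imaginary axis `f` vanishes by the formula for the characteristic function.
  have him : ∀ x : ℝ, ‖f (x * Complex.I)‖ ≤ 0 := by
    intro x
    have h := hchar (-x)
    have e : ∀ y : ℝ, Complex.exp (Complex.I * ((-x : ℝ) : ℂ) * y) =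
        Complex.exp (-(x * Complex.I * y)) := fun y => by
      congr 1
      push_cast
      ring
    have e2 : ∀ y : ℝ, Complex.exp (((-x : ℝ) : ℂ) * y * Complex.I) =
        Complex.exp (-(x * Complex.I * y)) := fun y => by
      congr 1
      push_cast
      ring
    rw [charFun_apply_real] at h
    simp only [e, e2] at h
    simp only [hf]
    rw [hH _ (by simp), h, laplaceExponent, sub_self, norm_zero]
  have h0 := PhragmenLindelof.right_half_plane_of_bounded_on_real (C := 0) hd
    ⟨1, one_lt_two, 0, Asymptotics.IsBigO.of_bound 2 ?_⟩ ⟨2, ?_⟩ him hz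
  · have := norm_le_zero_iff.1 h0
    simp only [hf, hH z hz] at this
    exact sub_eq_zero.1 this
  · rw [eventually_inf_principal]
    refine Eventually.of_forall fun w (hw : 0 < w.re) => ?_
    simpa using hbound w hw.le
  · rw [eventually_map]
    filter_upwards [eventually_ge_atTop 0] with x hx
    exact hbound x (by simpa using hx)

theorem IsSubordinatorLevyMeasure.ae_pos {ν : Measure ℝ} (h : IsSubordinatorLevyMeasure ν) :
    ∀ᵐ x ∂ν, 0 < x := by
  rw [ae_iff]
  simp only [not_lt]
  exact h.measure_Iic

theorem IsSubordinatorLevyMeasure.integrable_min {ν : Measure ℝ}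
    (h : IsSubordinatorLevyMeasure ν) : Integrable (fun x : ℝ => min 1 x) ν := by
  refine ⟨Continuous.aestronglyMeasurable (by fun_prop), ?_⟩
  rw [hasFiniteIntegral_iff_ofReal]
  · exact h.lintegral_lt_top
  · filter_upwards [h.ae_pos] with x hx using le_min zero_le_one hx.le

theorem laplaceExponent_prabhakarLevyMeasure {α σ γ : ℝ} (hα0 : 0 < α) (hα1 : α ≤ 1)
    (hγ : 0 < γ) (hσ1 : 1 ≤ σ) (hσγ : α * γ ≤ σ) (hσ2 : σ < 1 + α * γ) {s : ℝ} (hs : 0 ≤ s) :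
    laplaceExponent (prabhakarLevyMeasure α σ γ 1) s =
      -((prabhakarConst α σ γ * ∫ u in Set.Ioc 0 s, prabhakarLaplace α σ γ u : ℝ) : ℂ) := by
  have hν := isSubordinatorLevyMeasure_prabhakarLevyMeasure hα0 hα1 hγ hσ1 hσγ hσ2
  have h := integral_eq_lintegral_of_nonneg_ae (μ := prabhakarLevyMeasure α σ γ 1)
    (f := fun x => 1 - Real.exp (-(s * x))) ?_ (Continuous.aestronglyMeasurable (by fun_prop))
  · rw [lintegral_one_sub_exp_prabhakarLevyMeasure hα0 hα1 hγ hσ1 hσγ hσ2 hs,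
      ENNReal.toReal_ofReal] at h
    · rw [← h, ← integral_complex_ofReal, ← integral_neg, laplaceExponent]
      congr 1
      funext x
      push_cast
      ring
    · exact mul_nonneg (prabhakarConst_pos hα0 hγ hσ2).le
        (setIntegral_nonneg measurableSet_Ioc fun u hu => prabhakarLaplace_nonneg hu.1)
  · filter_upwards [hν.ae_pos] with x hx
    have := mul_nonneg hs hx.le
    simp only [Pi.zero_apply]
    linarith [Real.exp_le_one_iff.2 (neg_nonpos.2 this)]

theorem mainTheorem4 (α σ γ : ℝ) (hα0 : 0 < α) (hα1 : α ≤ 1) (hγ : 0 < γ)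
    (hσ1 : 1 ≤ σ) (hσγ : α * γ ≤ σ) (hσ2 : σ < 1 + α * γ) :
    ((∀ x : ℝ, 0 < x → 0 ≤ prabhakarLevyDensity α σ γ 1 x) ∧
      IsSubordinatorLevyMeasure (prabhakarLevyMeasure α σ γ 1)) ∧
    ∀ (Ω : Type*) [MeasurableSpace Ω] (P : Measure Ω) [IsProbabilityMeasure P]
      (X : ℝ≥0 → Ω → ℝ), IsPrabhakarProcess α σ γ 1 X P →
      ∀ s : ℝ, 0 ≤ s →
        ((∫ x, Real.exp (-(s * x)) ∂(P.map (X 1)) : ℝ) : ℂ) =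
          Complex.exp (-(((s ^ (α * γ - σ + 1) * Real.Gamma γ /
              Real.Gamma (γ + 1 + (1 - σ) / α) : ℝ) : ℂ) *
            gaussHypergeometric (γ : ℂ) ((γ + (1 - σ) / α : ℝ) : ℂ)
              ((1 + γ + (1 - σ) / α : ℝ) : ℂ) ((-(s ^ α) : ℝ) : ℂ))) := by
  have hν := isSubordinatorLevyMeasure_prabhakarLevyMeasure hα0 hα1 hγ hσ1 hσγ hσ2
  refine ⟨⟨fun x hx => ?_, hν⟩, ?_⟩
  · rw [prabhakarLevyDensity_one_eq hx]
    exact mul_nonneg (prabhakarConst_pos hα0 hγ hσ2).le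
      (mul_nonneg (inv_pos.2 hx).le (prabhakarKernel_nonneg hα0 hα1 hγ hσ1 hσγ hx))
  intro Ω _ P _ X hX s hs
  have hXm := hX.isSubordinator.aemeasurable 1
  have : IsProbabilityMeasure (P.map (X 1)) := Measure.isProbabilityMeasure_map hXm
  have hμ0 : ∀ᵐ x ∂(P.map (X 1)), 0 ≤ x := by
    rw [ae_map_iff hXm measurableSet_Ici]
    filter_upwards [hX.isSubordinator.start_zero, hX.isSubordinator.mono 0 1 zero_le_one]
      with ω h0 h1
    rwa [h0] at h1
  -- At `s = 0` the exponent of `s` is positive, so the prefactor of `₂F₁` vanishes.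
  rcases hs.eq_or_lt with rfl | hs0
  · simp [Real.zero_rpow (show α * γ - σ + 1 ≠ 0 by linarith)]
  have hchar : ∀ u : ℝ, charFun (P.map (X 1)) u = Complex.exp
      (∫ x : ℝ, (Complex.exp (Complex.I * u * x) - 1) ∂(prabhakarLevyMeasure α σ γ 1)) := by
    intro u
    simpa using hX.hasLevyMeasure.charFun_eq 1 u
  have key := integral_cexp_neg_mul_eq_exp_laplaceExponent hμ0 (hν.ae_pos.mono fun x hx => hx.le)
    hν.integrable_min hchar (z := (s : ℂ)) (by simpa using hs)
  rw [laplaceExponent_prabhakarLevyMeasure hα0 hα1 hγ hσ1 hσγ hσ2 hs,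
    prabhakarConst_mul_integral_eq hα0 hγ hσ2 hs0] at key
  rw [← key, ← integral_complex_ofReal]
  congr 1
  funext x
  push_cast
  rfl
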